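/- **Setting.** Let $T>0$ and $d,k\in\mathbb N$. Let $\mathbb D^d$ be the space of càdlàg functions $L:[0,T]\to\mathbb R^d$, and $\mathbb D^k_\uparrow$ the space of componentwise nondecreasing càdlàg functions $A:[0,T]\to\mathbb R^k$ with $A_0\ge 0$, each with the $\sigma$-algebra generated by the coordinate maps. On $\mathbb D^d\times\mathbb D^k_\uparrow$, with coordinate processes $(L,A)$, put $\mathcal F^L_t=\sigma(L_s;s\le t)$, $\mathcal F^A_t=\sigma(A_s;s\le t)$ and $\mathcal F^L_{t+}=\bigcap_{s>t}\mathcal F^L_s$ (with $\mathcal F^L_{T+}=\mathcal F^L_T$), without completion. Let $\mathbb P_0$ be a probability measure on $\mathbb D^d$. A probability measure $\mathbb P$ on $\mathbb D^d\times\mathbb D^k_\uparrow$ is *admissible*, $\mathbb P\in\mathcal A$, if the law of $L$ under $\mathbb P$ is $\mathbb P_0$ and, for each $t\in[0,T]$, the $\sigma$-algebras $\mathcal F^A_t$ and $\mathcal F^L_T$ are $\mathbb P$-conditionally independent given $\mathcal F^L_{t+}$. It is *strongly admissible* if, in addition, $\mathcal F^A_t\subseteq\mathcal F^L_{t+}$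 up to $\mathbb P$-negligible sets, for each $t\in[0,T]$. Let $f:[0,T]\to[0,\infty)^k$ be continuous, and let $g,h:\mathbb R^d\times[0,\infty)^k\to[0,\infty)$ be measurable functions such that $g(l,\cdot)$ and $h(l,\cdot)$ are convex and lower semicontinuous on $[0,\infty)^k$ for each $l\in\mathbb R^d$. Set $$C(L,A)=\int_{[0,T]}f(t)\,dA_t+\int_0^T h(L_t,A_t)\,dt+g(L_T,A_T),\qquad \int_{[0,T]}f(t)\,dA_t:=\sum_{i=1}^k\Big(f_i(0)A^i_0+\int_{(0,T]}f_i(t)\,dA^i_t\Big),$$ $J(\mathbb P)=\mathbb E^{\mathbb P}[C(L,A)]\in[0,\infty]$ and $V=\inf_{\mathbb P\in\mathcal A}J(\mathbb P)$. A *strong solution* is a strongly admissible $\hat{\mathbb P}$ with $J(\hat{\mathbb P})=V<\infty$. **Theorem 2.5 (Existence under linear coercivity).** Suppose that there exist constants $\kappa,K>0$ such that $$\mathbb E^{\mathbb P}[C(L,A)]\ \ge\ \kappa\,\mathbb E^{\mathbb P}[|A_T|]\qquad\text{for all }\mathbb P\in\mathcal A\text{ with }\mathbb E^{\mathbb P}[|A_T|]\ge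 K,$$ where $|\cdot|$ is the Euclidean norm. If $V<\infty$, then the monotone-follower problem admits a strong solution. -/

import Mathlib

open MeasureTheory Filter Topology Set
open scoped ENNReal

namespace MonotoneFollower

noncomputable section

/-- The time interval `[0,T]`. -/
abbrev Time (T : ℝ) : Type := Set.Icc (0 : ℝ) T

/-- The initial time `0` of `[0,T]`. -/
def initialTime (T : ℝ) [hT : Fact (0 < T)] : Time T := ⟨0, le_rfl, hT.out.le⟩

/-- The terminal time `T` of `[0,T]`. -/
def finalTime (T : ℝ) [hT : Fact (0 < T)] : Time T := ⟨T, hT.out.le, le_rfl⟩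

instance (T : ℝ) : CompactIccSpace (Time T) := ⟨fun {_ _} => isClosed_Icc.isCompact⟩

/-- Lebesgue measure on `[0,T]`. -/
def lebesgue (T : ℝ) : Measure (Time T) := (volume : Measure ℝ).comap Subtype.val

/-- Càdlàg functions on `[0,T]`: right-continuous at every point, with left limits. (At `t = 0`
the left neighbourhood filter is trivial, so that nothing is required of the left limit there.) -/
def IsCadlag {T : ℝ} {E : Type*} [TopologicalSpace E] (x : Time T → E) : Prop :=
  ∀ t, ContinuousWithinAt x (Ici t) t ∧ ∃ l, Tendsto x (𝓝[<] t) (𝓝 l)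

/-- The Skorokhod space of `ℝ^d`-valued càdlàg functions on `[0,T]`. It carries the σ-algebra
generated by the coordinate maps: this is the measurable structure of a subtype of a product. -/
abbrev SkorokhodSpace (T : ℝ) (d : ℕ) : Type :=
  {x : Time T → EuclideanSpace ℝ (Fin d) // IsCadlag x}

/-- The space of càdlàg, componentwise nondecreasing functions `a : [0,T] → ℝ^k` with `a 0 ≥ 0`,
with the σ-algebra generated by the coordinate maps. -/
abbrev MonotonePathSpace (T : ℝ) [Fact (0 < T)] (k : ℕ) : Type :=
  {a : Time T → EuclideanSpace ℝ (Fin k) //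
    IsCadlag a ∧ (∀ i, Monotone fun t => a t i) ∧ ∀ i, 0 ≤ a (initialTime T) i}

/-- The canonical space of pairs `(L, A)`: an `ℝ^d`-valued càdlàg path `L` (the target) and an
`ℝ^k`-valued nondecreasing càdlàg path `A` (the follower). The product σ-algebra is the one
generated by all coordinate maps. -/
abbrev PathSpace (T : ℝ) [Fact (0 < T)] (d k : ℕ) : Type :=
  SkorokhodSpace T d × MonotonePathSpace T k

section Filtrations

variable (T : ℝ) [Fact (0 < T)] (d k : ℕ)

/-- `σ(L_u ; u ≤ s)`, for a real `s`. For `s ≥ T` this is `σ(L_u ; u ∈ [0,T])`. -/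
abbrev sigmaL (s : ℝ) : MeasurableSpace (PathSpace T d k) :=
  ⨆ u : Time T, ⨆ _ : (u : ℝ) ≤ s,
    MeasurableSpace.comap (fun ω : PathSpace T d k => ω.1.1 u) inferInstance

/-- `σ(A_u ; u ≤ s)`, for a real `s`. -/
abbrev sigmaA (s : ℝ) : MeasurableSpace (PathSpace T d k) :=
  ⨆ u : Time T, ⨆ _ : (u : ℝ) ≤ s,
    MeasurableSpace.comap (fun ω : PathSpace T d k => ω.2.1 u) inferInstance

/-- The right-continuous augmentation `⋂_{s > t} σ(L_u ; u ≤ s)`. For `t = T` it is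
`σ(L_u ; u ∈ [0,T])`. -/
abbrev sigmaLPlus (t : ℝ) : MeasurableSpace (PathSpace T d k) :=
  ⨅ s : ℝ, ⨅ _ : t < s, sigmaL T d k s

end Filtrations

/-- Conditional independence of two sub-σ-algebras `m₁`, `m₂` given the sub-σ-algebra `m'` under
a probability `P`: `P(S₁ ∩ S₂ | m') = P(S₁ | m') P(S₂ | m')` almost surely, for all `S₁ ∈ m₁`,
`S₂ ∈ m₂`. -/
def CondIndependent {Ω : Type*} {m0 : MeasurableSpace Ω} (m' m₁ m₂ : MeasurableSpace Ω)
    (P : Measure[m0] Ω) : Prop :=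
  ∀ S₁ S₂ : Set Ω, MeasurableSet[m₁] S₁ → MeasurableSet[m₂] S₂ →
    P[(S₁ ∩ S₂).indicator (fun _ => (1 : ℝ)) | m'] =ᵐ[P]
      P[S₁.indicator (fun _ => (1 : ℝ)) | m'] * P[S₂.indicator (fun _ => (1 : ℝ)) | m']

section Problem

variable {T : ℝ} [Fact (0 < T)] {d k : ℕ}

/-- Admissible laws `P` of `(L, A)`: the `L`-marginal is `P₀` and, for each `t ∈ [0,T]`,
conditionally on `F^L_{t+}` the σ-algebras `F^A_t` and `F^L_T` are `P`-independent. -/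
structure IsAdmissible (P₀ : Measure (SkorokhodSpace T d)) (P : Measure (PathSpace T d k)) :
    Prop where
  isProbabilityMeasure : IsProbabilityMeasure P
  marginal : P.map Prod.fst = P₀
  nonanticipative : ∀ t : Time T,
    CondIndependent (sigmaLPlus T d k t) (sigmaA T d k t) (sigmaL T d k T) P

/-- Strongly admissible laws: admissible, and `F^A_t ⊆ F^L_{t+}` for each `t ∈ [0,T]`, up to
`P`-negligible sets. -/
structure IsStronglyAdmissible (P₀ : Measure (SkorokhodSpace T d))
    (P : Measure (PathSpace T d k)) : Prop where
  isAdmissible : IsAdmissible P₀ P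
  adapted : ∀ (t : Time T) (S : Set (PathSpace T d k)), MeasurableSet[sigmaA T d k t] S →
    ∃ S' : Set (PathSpace T d k), MeasurableSet[sigmaLPlus T d k t] S' ∧ S =ᵐ[P] S'

/-- The orthant `[0,∞)^k`. -/
def orthant (k : ℕ) : Set (EuclideanSpace ℝ (Fin k)) := {a | ∀ i, 0 ≤ a i}

variable (T d k) in
/-- The ingredients of a cost functional: a continuous `f : [0,T] → [0,∞)^k` and measurable
`g, h : ℝ^d × [0,∞)^k → [0,∞)` which are convex in the second variable. Only the values of
`g` and `h` on `ℝ^d × [0,∞)^k` are relevant. -/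
structure CostData where
  f : Time T → EuclideanSpace ℝ (Fin k)
  g : EuclideanSpace ℝ (Fin d) → EuclideanSpace ℝ (Fin k) → ℝ
  h : EuclideanSpace ℝ (Fin d) → EuclideanSpace ℝ (Fin k) → ℝ
  f_continuous : Continuous f
  f_mem : ∀ t, f t ∈ orthant k
  g_measurable : Measurable fun p : EuclideanSpace ℝ (Fin d) × orthant k => g p.1 p.2
  h_measurable : Measurable fun p : EuclideanSpace ℝ (Fin d) × orthant k => h p.1 p.2
  g_nonneg : ∀ l, ∀ a ∈ orthant k, 0 ≤ g l a
  h_nonneg : ∀ l, ∀ a ∈ orthant k, 0 ≤ h l a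
  g_convex : ∀ l, ConvexOn ℝ (orthant k) (g l)
  h_convex : ∀ l, ConvexOn ℝ (orthant k) (h l)

/-- The `i`-th component of a nondecreasing càdlàg path, as a Stieltjes function on `[0,T]`. Its
measure is the Lebesgue–Stieltjes measure on `(0,T]`; the point `0` has measure zero. -/
def stieltjes (a : MonotonePathSpace T k) (i : Fin k) : StieltjesFunction (Time T) where
  toFun t := a.1 t i
  mono' := a.2.2.1 i
  right_continuous' t :=
    (EuclideanSpace.proj (𝕜 := ℝ) i).continuous.continuousAt.comp_continuousWithinAt (a.2.1 t).1

/-- `∫_{[0,T]} f(t) dA_t = ∑ᵢ (fᵢ(0) Aⁱ_0 + ∫_{(0,T]} fᵢ(t) dAⁱ_t)`. -/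
def controlCost (f : Time T → EuclideanSpace ℝ (Fin k)) (a : MonotonePathSpace T k) : ℝ≥0∞ :=
  ∑ i, (ENNReal.ofReal (f (initialTime T) i * a.1 (initialTime T) i) +
    ∫⁻ t, ENNReal.ofReal (f t i) ∂(stieltjes a i).measure)

/-- The cost functional
`C(L,A) = ∫_{[0,T]} f(t) dA_t + ∫_0^T h(L_t,A_t) dt + g(L_T,A_T) ∈ [0,∞]`. -/
def CostData.cost (c : CostData T d k) (ω : PathSpace T d k) : ℝ≥0∞ :=
  controlCost c.f ω.2 +
    (∫⁻ t, ENNReal.ofReal (c.h (ω.1.1 t) (ω.2.1 t)) ∂(lebesgue T)) +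
    ENNReal.ofReal (c.g (ω.1.1 (finalTime T)) (ω.2.1 (finalTime T)))

/-- The expected cost `J(P) = E^P[C(L,A)] ∈ [0,∞]`. -/
def CostData.expectedCost (c : CostData T d k) (P : Measure (PathSpace T d k)) : ℝ≥0∞ :=
  ∫⁻ ω, c.cost ω ∂P

/-- The value `V = inf_P J(P)`, over all admissible `P`. -/
def CostData.value (c : CostData T d k) (P₀ : Measure (SkorokhodSpace T d)) : ℝ≥0∞ :=
  ⨅ (P : Measure (PathSpace T d k)) (_ : IsAdmissible P₀ P), c.expectedCost P

/-- Weak solutions: admissible laws with finite cost which attain the value. -/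
structure CostData.IsWeakSolution (c : CostData T d k) (P₀ : Measure (SkorokhodSpace T d))
    (P : Measure (PathSpace T d k)) : Prop where
  isAdmissible : IsAdmissible P₀ P
  cost_lt_top : c.expectedCost P < ∞
  optimal : c.value P₀ = c.expectedCost P

/-- Strong solutions: weak solutions which are strongly admissible. -/
structure CostData.IsStrongSolution (c : CostData T d k) (P₀ : Measure (SkorokhodSpace T d))
    (P : Measure (PathSpace T d k)) : Prop where
  isWeakSolution : c.IsWeakSolution P₀ P
  isStronglyAdmissible : IsStronglyAdmissible P₀ P

/-- `E^P[|A_T|]`, with the Euclidean norm. -/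
def expectedTotal (P : Measure (PathSpace T d k)) : ℝ≥0∞ :=
  ∫⁻ ω, ‖ω.2.1 (finalTime T)‖ₑ ∂P

/-- Linear coercivity: there are constants `κ, K > 0` with `E^P[C(L,A)] ≥ κ E^P[|A_T|]` for every
admissible `P` with `E^P[|A_T|] ≥ K`. -/
def CostData.LinearlyCoercive (c : CostData T d k) (P₀ : Measure (SkorokhodSpace T d)) : Prop :=
  ∃ κ K : ℝ, 0 < κ ∧ 0 < K ∧ ∀ P : Measure (PathSpace T d k), IsAdmissible P₀ P →
    ENNReal.ofReal K ≤ expectedTotal P →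
      ENNReal.ofReal κ * expectedTotal P ≤ c.expectedCost P

end Problem

end

end MonotoneFollower

/-! The problem is reduced to controls that are functions of the target; a minimizing sequence of
such controls is then chosen so that it converges almost surely, without extraction of subsequences.

Reduction. Given an admissible law with `E|A_T|` finite, replace the follower by its conditional
mean given the whole target. By nonanticipativity, conditioning on `F^L_T` or on `F^L_{t+}` gives
the same result (`condExp_eq_of_condIndependent`), so the mean is adapted to the completed
right-continuous filtration of `L`. It is nondecreasing in time and has a right-continuous version
(`IsAdmissible.meanControl_ae_eq`). The cost does not increase
(`IsAdmissible.lintegral_cost_meanControl_le`): by integration by parts the linear term sees only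
the mean path, and Jensen's inequality handles `g` and `h`. Conversely, the law of the graph of an
adapted control is strongly admissible (`IsControl.isStronglyAdmissible`).

Compactness. Since the cost is convex, the controls with cost at most `v n`, where `v n` decreases
to the value, form nested sets closed under midpoints. Almost minimize over them the mean of `exp
(-A)`, averaged over a countable dense set of times. By `exp_gap_eq_sq` the midpoint gap of this
functional is the squared L² distance between the functions `exp (-A / 2)`, so these converge almost
surely. Coercivity bounds `E|A_T|`, and by Fatou's lemma `liminf |A_T|` is finite almost surely;
hence the limits of the exponentials are positive and `A` itself converges
(`exists_seq_controls_tendsto`).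

Limit. The right-continuous regularization of the limiting values is again a control. As in Helly's
theorem, the paths converge to it at `T` and at almost every time, so the linear cost converges and
the other costs are lower semicontinuous (`CostData.cost_le_liminf`). A last use of Fatou's lemma
shows that the limit costs at most the value. -/

namespace MonotoneFollower

/-! ### Joint measurability of right-continuous processes -/

section RightContinuous

/-- The grid point to the right of `t`: a map `[0,T] → [0,T]` with countable range. -/
noncomputable def gridPoint (T : ℝ) [hT : Fact (0 < T)] (n m : ℕ) : Time T :=
  ⟨min (((m : ℝ) + 1) / (n + 1)) T, le_min (by positivity) hT.out.le, min_le_right _ _⟩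

variable {T : ℝ} [hT : Fact (0 < T)]

/-- Adding one to the floor puts the grid point to the right of `t`, at distance at most `1 / (n +
1)`; truncation at `T` preserves both properties. Approach from the right is what allows
right-continuity to be used. -/
theorem tendsto_gridPoint (t : Time T) :
    Tendsto (fun n : ℕ => gridPoint T n ⌊(n + 1) * (t : ℝ)⌋₊) atTop (𝓝[≥] t) := by
  refine tendsto_nhdsWithin_iff.2 ⟨?_, Eventually.of_forall fun n => ?_⟩
  · rw [tendsto_subtype_rng]
    have h0 : Tendsto (fun n : ℕ => (t : ℝ) + 1 / ((n : ℝ) + 1)) atTop (𝓝 (t : ℝ)) := by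
      simpa using tendsto_const_nhds.add (tendsto_one_div_add_atTop_nhds_zero_nat (𝕜 := ℝ))
    refine tendsto_of_tendsto_of_tendsto_of_le_of_le tendsto_const_nhds h0 (fun n => ?_)
      fun n => ?_
    · refine le_min ?_ t.2.2
      rw [le_div_iff₀ (by positivity), mul_comm]
      exact (Nat.lt_floor_add_one _).le
    · refine (min_le_left _ _).trans ?_
      have hn : (0 : ℝ) < n + 1 := by positivity
      rw [div_le_iff₀ hn, add_mul (t : ℝ), div_mul_cancel₀ _ hn.ne']
      have := Nat.floor_le (mul_nonneg (by positivity : (0 : ℝ) ≤ n + 1) t.2.1)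
      linarith
  · change (t : ℝ) ≤ min _ T
    refine le_min ?_ t.2.2
    rw [le_div_iff₀ (by positivity), mul_comm]
    exact (Nat.lt_floor_add_one _).le

/-- A right-continuous process is jointly measurable. -/
theorem measurable_uncurry_of_rightContinuous {X E : Type*} [MeasurableSpace X]
    [TopologicalSpace E] [TopologicalSpace.PseudoMetrizableSpace E] [MeasurableSpace E]
    [BorelSpace E] {x : X → Time T → E} (hx : ∀ t, Measurable fun ω => x ω t)
    (hc : ∀ ω t, ContinuousWithinAt (x ω) (Ici t) t) :
    Measurable fun p : X × Time T => x p.1 p.2 := by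
  refine measurable_of_tendsto_metrizable
    (f := fun (n : ℕ) (p : X × Time T) => x p.1 (gridPoint T n ⌊(n + 1) * (p.2 : ℝ)⌋₊))
    (fun n => ?_) (tendsto_pi_nhds.2 fun p => (hc p.1 p.2).tendsto.comp (tendsto_gridPoint p.2))
  have h1 : Measurable fun p : X × ℕ => x p.1 (gridPoint T n p.2) :=
    measurable_from_prod_countable_left fun m => hx (gridPoint T n m)
  have h2 : Measurable fun p : X × Time T => (p.1, ⌊((n : ℝ) + 1) * (p.2 : ℝ)⌋₊) := by
    refine measurable_fst.prodMk (Nat.measurable_floor.comp ?_)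
    exact (measurable_subtype_coe.comp measurable_snd).const_mul _
  exact h1.comp h2

end RightContinuous

/-! ### Coordinates and measurability of paths -/

section Paths

variable {T : ℝ} [hT : Fact (0 < T)] {d k : ℕ}

theorem initialTime_le (t : Time T) : initialTime T ≤ t := t.2.1

theorem le_finalTime (t : Time T) : t ≤ finalTime T := t.2.2

theorem MonotonePathSpace.nonneg (a : MonotonePathSpace T k) (t : Time T) (i : Fin k) :
    0 ≤ a.1 t i :=
  (a.2.2.2 i).trans (a.2.2.1 i (initialTime_le t))

theorem MonotonePathSpace.mem_orthant (a : MonotonePathSpace T k) (t : Time T) :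
    a.1 t ∈ orthant k := a.nonneg t

theorem MonotonePathSpace.le_final (a : MonotonePathSpace T k) (t : Time T) (i : Fin k) :
    a.1 t i ≤ a.1 (finalTime T) i := a.2.2.1 i (le_finalTime t)

theorem MonotonePathSpace.measurable_eval (t : Time T) :
    Measurable fun a : MonotonePathSpace T k => a.1 t :=
  (measurable_pi_apply t).comp measurable_subtype_coe

theorem SkorokhodSpace.measurable_eval {T : ℝ} {d : ℕ} (t : Time T) :
    Measurable fun l : SkorokhodSpace T d => l.1 t :=
  (measurable_pi_apply t).comp measurable_subtype_coe

theorem MonotonePathSpace.measurable_eval_uncurry :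
    Measurable fun p : MonotonePathSpace T k × Time T => p.1.1 p.2 :=
  measurable_uncurry_of_rightContinuous MonotonePathSpace.measurable_eval fun a t => (a.2.1 t).1

theorem SkorokhodSpace.measurable_eval_uncurry :
    Measurable fun p : SkorokhodSpace T d × Time T => p.1.1 p.2 :=
  measurable_uncurry_of_rightContinuous SkorokhodSpace.measurable_eval fun a t => (a.2 t).1

theorem measurable_euclideanSpace_apply (i : Fin k) :
    Measurable fun x : EuclideanSpace ℝ (Fin k) => x i :=
  (EuclideanSpace.proj (𝕜 := ℝ) i).continuous.measurable

theorem measurable_euclideanSpace_iff {X : Type*} [MeasurableSpace X]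
    {f : X → EuclideanSpace ℝ (Fin k)} : Measurable f ↔ ∀ i, Measurable fun x => f x i := by
  refine ⟨fun h i => (measurable_euclideanSpace_apply i).comp h, fun h => ?_⟩
  have h1 : Measurable fun x => WithLp.ofLp (f x) := measurable_pi_iff.2 h
  exact (PiLp.continuous_toLp 2 fun _ : Fin k => ℝ).measurable.comp h1

theorem continuous_euclideanSpace_iff {X : Type*} [TopologicalSpace X]
    {f : X → EuclideanSpace ℝ (Fin k)} : Continuous f ↔ ∀ i, Continuous fun x => f x i := by
  refine ⟨fun h i => (EuclideanSpace.proj (𝕜 := ℝ) i).continuous.comp h, fun h => ?_⟩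
  have h1 : Continuous fun x => WithLp.ofLp (f x) := continuous_pi_iff.2 h
  exact (PiLp.continuous_toLp 2 fun _ : Fin k => ℝ).comp h1

theorem tendsto_euclideanSpace_iff {X : Type*} {F : Filter X}
    {f : X → EuclideanSpace ℝ (Fin k)} {y : EuclideanSpace ℝ (Fin k)} :
    Tendsto f F (𝓝 y) ↔ ∀ i, Tendsto (fun x => f x i) F (𝓝 (y i)) := by
  refine ⟨fun h i => ((EuclideanSpace.proj (𝕜 := ℝ) i).continuous.tendsto y).comp h, fun h => ?_⟩
  have h1 : Tendsto (fun x => WithLp.ofLp (f x)) F (𝓝 (WithLp.ofLp y)) := tendsto_pi_nhds.2 h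
  exact ((PiLp.continuous_toLp 2 fun _ : Fin k => ℝ).tendsto _).comp h1

theorem isClosed_orthant : IsClosed (orthant k) := by
  simp only [orthant, Set.ofPred_forall]
  exact isClosed_iInter fun i =>
    isClosed_le continuous_const (EuclideanSpace.proj (𝕜 := ℝ) i).continuous

theorem MonotonePathSpace.measurable_mk {X : Type*} [MeasurableSpace X]
    {A : X → MonotonePathSpace T k} (h : ∀ t i, Measurable fun x => (A x).1 t i) :
    Measurable A :=
  Measurable.subtype_mk (measurable_pi_iff.2 fun t => measurable_euclideanSpace_iff.2 (h t))

/-- A family of nonnegative, nondecreasing, right-continuous real functions defines a path in the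
space of nondecreasing càdlàg functions. -/
noncomputable def MonotonePathSpace.mk' (x : Time T → Fin k → ℝ) (h0 : ∀ t i, 0 ≤ x t i)
    (hm : ∀ i, Monotone fun t => x t i)
    (hc : ∀ i t, ContinuousWithinAt (fun s => x s i) (Ici t) t) : MonotonePathSpace T k :=
  ⟨fun t => WithLp.toLp 2 (x t), fun t => ⟨tendsto_euclideanSpace_iff.2 fun i => hc i t,
    WithLp.toLp 2 fun i => sSup ((fun s => x s i) '' Iio t),
    tendsto_euclideanSpace_iff.2 fun i => (hm i).tendsto_nhdsLT t⟩, hm, h0 _⟩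

theorem MonotonePathSpace.continuousWithinAt_apply (a : MonotonePathSpace T k) (t : Time T)
    (i : Fin k) : ContinuousWithinAt (fun s => a.1 s i) (Ici t) t :=
  (EuclideanSpace.proj (𝕜 := ℝ) i).continuous.continuousAt.comp_continuousWithinAt (a.2.1 t).1

instance : IsFiniteMeasure (lebesgue T) := by
  constructor
  rw [lebesgue, comap_subtype_coe_apply measurableSet_Icc]
  simp only [image_univ, Subtype.range_coe_subtype]
  exact isCompact_Icc.measure_lt_top

end Paths

/-! ### The linear control cost: integration by parts and polynomial approximation -/

section ControlCost

open Polynomial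

variable {T : ℝ} [hT : Fact (0 < T)] {d k : ℕ}

theorem stieltjes_measure_Iic (a : MonotonePathSpace T k) (i : Fin k) (s : Time T) :
    (stieltjes a i).measure (Iic s) = ENNReal.ofReal (a.1 s i - a.1 (initialTime T) i) := by
  -- The Stieltjes measure gives no mass to the least point, which is why the jump at `0` is a
  -- separate term in the cost.
  have h1 : (Iic s) \ botSet = Ioc (initialTime T) s := by
    rw [botSet_eq_singleton_of_isBot (initialTime_le (T := T))]
    ext u
    simp only [Set.mem_sdiff, mem_Iic, mem_singleton_iff, mem_Ioc]
    constructor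
    · rintro ⟨h, h'⟩
      exact ⟨lt_of_le_of_ne (initialTime_le u) (Ne.symm h'), h⟩
    · rintro ⟨h, h'⟩
      exact ⟨h', h.ne'⟩
  rw [← measure_sdiff_null (s := Iic s) (stieltjes a i).measure_botSet, h1,
    StieltjesFunction.measure_Ioc]
  rfl

theorem stieltjes_measure_univ (a : MonotonePathSpace T k) (i : Fin k) :
    (stieltjes a i).measure univ =
      ENNReal.ofReal (a.1 (finalTime T) i - a.1 (initialTime T) i) := by
  rw [← stieltjes_measure_Iic]
  congr 1
  ext u
  simpa using le_finalTime u

instance (a : MonotonePathSpace T k) (i : Fin k) : IsFiniteMeasure (stieltjes a i).measure :=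
  ⟨by rw [stieltjes_measure_univ]; exact ENNReal.ofReal_lt_top⟩

/-- The real-valued version of the control cost. -/
noncomputable def realControlCost (f : Time T → EuclideanSpace ℝ (Fin k))
    (a : MonotonePathSpace T k) : ℝ :=
  ∑ i, (f (initialTime T) i * a.1 (initialTime T) i + ∫ t, f t i ∂(stieltjes a i).measure)

theorem integrable_of_continuous_time {T : ℝ} {f : Time T → ℝ} (hf : Continuous f)
    (μ : Measure (Time T)) [IsFiniteMeasure μ] : Integrable f μ := by
  have : CompactSpace (Time T) := isCompact_iff_compactSpace.1 isCompact_Icc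
  exact hf.integrable_of_hasCompactSupport (HasCompactSupport.of_compactSpace f)

theorem continuous_coord {T : ℝ} {k : ℕ} {f : Time T → EuclideanSpace ℝ (Fin k)}
    (hf : Continuous f) (i : Fin k) : Continuous fun t => f t i :=
  continuous_euclideanSpace_iff.1 hf i

theorem controlCost_eq_ofReal {f : Time T → EuclideanSpace ℝ (Fin k)} (hf : Continuous f)
    (hf0 : ∀ t, f t ∈ orthant k) (a : MonotonePathSpace T k) :
    controlCost f a = ENNReal.ofReal (realControlCost f a) := by
  have h0 : ∀ i, 0 ≤ f (initialTime T) i * a.1 (initialTime T) i := fun i =>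
    mul_nonneg (hf0 _ i) (a.nonneg _ i)
  have h1 : ∀ i, 0 ≤ ∫ t, f t i ∂(stieltjes a i).measure := fun i =>
    integral_nonneg fun t => hf0 t i
  rw [controlCost, realControlCost, ENNReal.ofReal_sum_of_nonneg fun i _ => add_nonneg (h0 i) (h1 i)]
  refine Finset.sum_congr rfl fun i _ => ?_
  rw [ENNReal.ofReal_add (h0 i) (h1 i), ofReal_integral_eq_lintegral_ofReal
    (integrable_of_continuous_time (continuous_coord hf i) _) (ae_of_all _ fun t => hf0 t i)]

theorem realControlCost_nonneg {f : Time T → EuclideanSpace ℝ (Fin k)}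
    (hf0 : ∀ t, f t ∈ orthant k) (a : MonotonePathSpace T k) : 0 ≤ realControlCost f a :=
  Finset.sum_nonneg fun i _ => add_nonneg (mul_nonneg (hf0 _ i) (a.nonneg _ i))
    (integral_nonneg fun t => hf0 t i)

/-- The control cost of a polynomial integrand, in the form given by integration by parts. -/
noncomputable def polyControlCost (p : Fin k → ℝ[X]) (a : MonotonePathSpace T k) : ℝ :=
  ∑ i, ((p i).eval T * a.1 (finalTime T) i -
    ∫ s, (p i).derivative.eval (s : ℝ) * a.1 s i ∂(lebesgue T))

theorem continuous_eval_time {T : ℝ} (p : ℝ[X]) : Continuous fun s : Time T => p.eval (s : ℝ) :=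
  p.continuous.comp continuous_subtype_val

theorem exists_norm_eval_le {T : ℝ} (p : ℝ[X]) : ∃ C : ℝ, ∀ s : Time T, ‖p.eval (s : ℝ)‖ ≤ C := by
  have : CompactSpace (Time T) := isCompact_iff_compactSpace.1 isCompact_Icc
  obtain ⟨C, hC⟩ := isCompact_univ.exists_bound_of_continuousOn
    (continuous_eval_time (T := T) p).continuousOn
  exact ⟨C, fun s => hC s (mem_univ s)⟩

theorem integrable_poly_mul_path (p : ℝ[X]) (a : MonotonePathSpace T k) (i : Fin k) :
    Integrable (fun s : Time T => p.eval (s : ℝ) * a.1 s i) (lebesgue T) := by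
  obtain ⟨C, hC⟩ := exists_norm_eval_le (T := T) p
  refine Integrable.of_bound (C := C * a.1 (finalTime T) i) ?_ (ae_of_all _ fun s => ?_)
  · exact ((continuous_eval_time p).measurable.mul ((measurable_euclideanSpace_apply i).comp
      (MonotonePathSpace.measurable_eval_uncurry.comp measurable_prodMk_left))).aestronglyMeasurable
  · rw [norm_mul, Real.norm_of_nonneg (a.nonneg s i)]
    exact mul_le_mul (hC s) (a.le_final s i) (a.nonneg s i) ((norm_nonneg _).trans (hC s))

theorem integral_lebesgue_indicator_derivative {T : ℝ} (p : ℝ[X]) (t : Time T) :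
    ∫ s, (Ici t).indicator (fun s : Time T => p.derivative.eval (s : ℝ)) s ∂(lebesgue T) =
      p.eval T - p.eval (t : ℝ) := by
  have h1 : ∀ s : Time T, (Ici t).indicator (fun s : Time T => p.derivative.eval (s : ℝ)) s =
      (Ici (t : ℝ)).indicator (fun s : ℝ => p.derivative.eval s) (s : ℝ) := by
    intro s
    simp only [indicator, mem_Ici, Subtype.coe_le_coe]
  simp_rw [h1]
  rw [lebesgue, integral_subtype_comap measurableSet_Icc
    (fun s => (Ici (t : ℝ)).indicator (fun s : ℝ => p.derivative.eval s) s),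
    setIntegral_indicator measurableSet_Ici]
  have h2 : Icc 0 T ∩ Ici (t : ℝ) = Icc (t : ℝ) T := by
    ext u
    simp only [mem_inter_iff, mem_Icc, mem_Ici]
    exact ⟨fun h => ⟨h.2, h.1.2⟩, fun h => ⟨⟨t.2.1.trans h.1, h.2⟩, h.1⟩⟩
  rw [h2, integral_Icc_eq_integral_Ioc, ← intervalIntegral.integral_of_le t.2.2]
  exact intervalIntegral.integral_eq_sub_of_hasDerivAt (fun x _ => p.hasDerivAt x)
    (p.derivative.continuous.intervalIntegrable _ _)

/-- Write `p(t)` as `p(T)` minus the integral of `p'` over `[t,T]` and exchange the integrals: the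
inner one becomes the mass `a_s - a_0` of `(0,s]`. The terms in `a_0` then cancel against the atom
at `0`. The right-hand side involves the path only through its values, with no Stieltjes measure. -/
theorem integral_stieltjes_polynomial (p : ℝ[X]) (a : MonotonePathSpace T k) (i : Fin k) :
    p.eval (0 : ℝ) * a.1 (initialTime T) i + ∫ t : Time T, p.eval (t : ℝ) ∂(stieltjes a i).measure =
      p.eval T * a.1 (finalTime T) i -
        ∫ s, p.derivative.eval (s : ℝ) * a.1 s i ∂(lebesgue T) := by
  set μ := (stieltjes a i).measure
  have h1 : ∀ t : Time T, p.eval (t : ℝ) = p.eval T -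
      ∫ s, (Ici t).indicator (fun s : Time T => p.derivative.eval (s : ℝ)) s ∂(lebesgue T) := by
    intro t
    rw [integral_lebesgue_indicator_derivative]; ring
  obtain ⟨C, hC⟩ := exists_norm_eval_le (T := T) p.derivative
  have hint : Integrable (Function.uncurry fun t s : Time T =>
      (Ici t).indicator (fun s : Time T => p.derivative.eval (s : ℝ)) s) (μ.prod (lebesgue T)) := by
    refine Integrable.of_bound (C := C) ?_ (ae_of_all _ ?_)
    · have : (Function.uncurry fun t s : Time T =>
          (Ici t).indicator (fun s : Time T => p.derivative.eval (s : ℝ)) s) =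
          {q : Time T × Time T | q.1 ≤ q.2}.indicator fun q => p.derivative.eval (q.2 : ℝ) := by
        ext q
        simp [indicator, Function.uncurry]
      rw [this]
      exact (((continuous_eval_time _).measurable.comp measurable_snd).indicator
        (measurableSet_le measurable_fst measurable_snd)).aestronglyMeasurable
    · rintro ⟨t, s⟩
      exact (norm_indicator_le_norm_self (fun s : Time T => p.derivative.eval (s : ℝ)) s).trans
        (hC s)
  have h2 : ∀ s : Time T, ∫ t, (Ici t).indicator (fun s : Time T => p.derivative.eval (s : ℝ)) s ∂μ =
      p.derivative.eval (s : ℝ) * (a.1 s i - a.1 (initialTime T) i) := by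
    intro s
    have : ∀ t : Time T, (Ici t).indicator (fun s : Time T => p.derivative.eval (s : ℝ)) s =
        (Iic s).indicator (fun _ => p.derivative.eval (s : ℝ)) t := by
      intro t
      simp [indicator]
    simp_rw [this]
    rw [integral_indicator_const _ measurableSet_Iic, measureReal_def, stieltjes_measure_Iic,
      ENNReal.toReal_ofReal (sub_nonneg.2 (a.2.2.1 i (initialTime_le s))), smul_eq_mul, mul_comm]
  have h3 : ∫ t : Time T, p.eval (t : ℝ) ∂μ =
      p.eval T * (a.1 (finalTime T) i - a.1 (initialTime T) i) -
      ∫ s, p.derivative.eval (s : ℝ) * (a.1 s i - a.1 (initialTime T) i) ∂(lebesgue T) := by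
    have h6 : Integrable (fun t => ∫ s, (Ici t).indicator
        (fun s : Time T => p.derivative.eval (s : ℝ)) s ∂(lebesgue T)) μ := hint.integral_prod_left
    simp_rw [h1]
    rw [integral_sub (integrable_const _) h6, integral_const, measureReal_def,
      stieltjes_measure_univ, ENNReal.toReal_ofReal (sub_nonneg.2 (a.2.2.1 i (initialTime_le _))),
      smul_eq_mul, mul_comm, integral_integral_swap hint]
    simp_rw [h2]
  have h4 : ∫ s : Time T, p.derivative.eval (s : ℝ) ∂(lebesgue T) = p.eval T - p.eval 0 := by
    have := integral_lebesgue_indicator_derivative p (initialTime T)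
    have h5 : Ici (initialTime T) = univ := by
      ext u
      simpa using initialTime_le u
    rw [h5] at this
    simpa [initialTime] using this
  rw [h3]
  simp_rw [mul_sub]
  rw [integral_sub (integrable_poly_mul_path _ a i)
    ((integrable_of_continuous_time (continuous_eval_time _) _).mul_const _),
    integral_mul_const, h4]
  ring

theorem exists_polynomial_approx {f : Time T → EuclideanSpace ℝ (Fin k)} (hf : Continuous f) :
    ∃ p : ℕ → Fin k → ℝ[X], ∀ n i (t : Time T),
      |(p n i).eval (t : ℝ) - f t i| ≤ 1 / ((n : ℝ) + 1) := by
  have h : ∀ (n : ℕ) (i : Fin k), ∃ q : ℝ[X], ∀ t : Time T,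
      |q.eval (t : ℝ) - f t i| ≤ 1 / ((n : ℝ) + 1) := by
    intro n i
    have hn : (0 : ℝ) < 1 / ((n : ℝ) + 1) := by positivity
    obtain ⟨q, hq⟩ := exists_polynomial_near_of_continuousOn 0 T
      (fun x => f (projIcc 0 T hT.out.le x) i)
      ((continuous_coord hf i).comp continuous_projIcc).continuousOn _ hn
    refine ⟨q, fun t => ?_⟩
    have := hq t t.2
    rw [projIcc_val] at this
    exact this.le
  choose p hp using h
  exact ⟨p, hp⟩

/-- Counting the atom at `0`, the integrator has total mass `a_T` in each coordinate. The error is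
therefore uniform over paths with bounded terminal value. -/
theorem abs_polyControlCost_sub_le {f : Time T → EuclideanSpace ℝ (Fin k)} (hf : Continuous f)
    {p : Fin k → ℝ[X]} {ε : ℝ} (hp : ∀ i (t : Time T), |(p i).eval (t : ℝ) - f t i| ≤ ε)
    (a : MonotonePathSpace T k) :
    |polyControlCost p a - realControlCost f a| ≤ ε * ∑ i, a.1 (finalTime T) i := by
  rw [polyControlCost, realControlCost, ← Finset.sum_sub_distrib, Finset.mul_sum]
  refine (Finset.abs_sum_le_sum_abs _ _).trans (Finset.sum_le_sum fun i _ => ?_)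
  rw [← integral_stieltjes_polynomial]
  have h1 := integrable_of_continuous_time (continuous_eval_time (T := T) (p i))
    (stieltjes a i).measure
  have h2 := integrable_of_continuous_time (continuous_coord hf i) (stieltjes a i).measure
  have h3 : |∫ t : Time T, ((p i).eval (t : ℝ) - f t i) ∂(stieltjes a i).measure| ≤
      ε * (a.1 (finalTime T) i - a.1 (initialTime T) i) := by
    have := norm_integral_le_of_norm_le_const (μ := (stieltjes a i).measure)
      (f := fun t : Time T => (p i).eval (t : ℝ) - f t i) (C := ε)
      (ae_of_all _ fun t : Time T => hp i t)
    rwa [measureReal_def, stieltjes_measure_univ,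
      ENNReal.toReal_ofReal (sub_nonneg.2 (a.2.2.1 i (initialTime_le _)))] at this
  rw [integral_sub h1 h2] at h3
  have h4 : |((p i).eval (0 : ℝ) - f (initialTime T) i) * a.1 (initialTime T) i| ≤
      ε * a.1 (initialTime T) i := by
    rw [abs_mul, abs_of_nonneg (a.nonneg _ i)]
    exact mul_le_mul_of_nonneg_right (hp i (initialTime T)) (a.nonneg _ i)
  calc _ = |((p i).eval (0 : ℝ) - f (initialTime T) i) * a.1 (initialTime T) i +
        (∫ t : Time T, (p i).eval (t : ℝ) ∂(stieltjes a i).measure -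
          ∫ t : Time T, f t i ∂(stieltjes a i).measure)| := by congr 1; ring
    _ ≤ _ := (abs_add_le _ _).trans (by linarith)

theorem tendsto_polyControlCost {f : Time T → EuclideanSpace ℝ (Fin k)} (hf : Continuous f)
    {p : ℕ → Fin k → ℝ[X]}
    (hp : ∀ n i (t : Time T), |(p n i).eval (t : ℝ) - f t i| ≤ 1 / ((n : ℝ) + 1))
    (a : MonotonePathSpace T k) :
    Tendsto (fun n => polyControlCost (p n) a) atTop (𝓝 (realControlCost f a)) := by
  rw [tendsto_iff_norm_sub_tendsto_zero]
  refine squeeze_zero (fun _ => norm_nonneg _)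
    (fun n => abs_polyControlCost_sub_le hf (hp n) a) ?_
  simpa using (tendsto_one_div_add_atTop_nhds_zero_nat (𝕜 := ℝ)).mul_const
    (∑ i, a.1 (finalTime T) i)

theorem measurable_polyControlCost (p : Fin k → ℝ[X]) :
    Measurable fun a : MonotonePathSpace T k => polyControlCost p a := by
  refine Finset.measurable_sum _ fun i _ => ?_
  refine Measurable.sub ((measurable_euclideanSpace_apply i).comp
    (MonotonePathSpace.measurable_eval _) |>.const_mul _) ?_
  refine StronglyMeasurable.measurable (StronglyMeasurable.integral_prod_right
    (f := fun (a : MonotonePathSpace T k) (s : Time T) =>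
      (p i).derivative.eval (s : ℝ) * a.1 s i) ?_)
  exact (((continuous_eval_time _).measurable.comp measurable_snd).mul
    ((measurable_euclideanSpace_apply i).comp
      MonotonePathSpace.measurable_eval_uncurry)).stronglyMeasurable

/-- Polynomial costs are visibly measurable in the path, being built from its values, and the cost
is their pointwise limit. -/
theorem measurable_realControlCost {f : Time T → EuclideanSpace ℝ (Fin k)} (hf : Continuous f) :
    Measurable fun a : MonotonePathSpace T k => realControlCost f a := by
  obtain ⟨p, hp⟩ := exists_polynomial_approx hf
  exact measurable_of_tendsto_metrizable (fun n => measurable_polyControlCost (p n))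
    (tendsto_pi_nhds.2 fun a => tendsto_polyControlCost hf hp a)

end ControlCost

/-! ### Right-continuous regularization and Helly convergence -/

section Regularization

variable {T : ℝ} [hT : Fact (0 < T)] {k : ℕ} {q : ℕ → Time T}

/-- The right-continuous regularization at time `t` of values `x n`, prescribed at times `q n`. -/
noncomputable def regValue (q : ℕ → Time T) (x : ℕ → Fin k → ℝ) (t : Time T) (i : Fin k) : ℝ :=
  ⨅ n : {n // t < q n ∨ q n = finalTime T}, max (x n i) 0

/-- The maximum with `0` bounds the infimum from below for arbitrary data, so a genuine path results
even on the null set where the data are not monotone. The clause `q n = finalTime T` keeps the index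
set nonempty at `t = T`. -/
theorem regValue_le_max (x : ℕ → Fin k → ℝ) {t : Time T} (i : Fin k) {n : ℕ}
    (hn : t < q n ∨ q n = finalTime T) : regValue q x t i ≤ max (x n i) 0 :=
  ciInf_le (f := fun n : {n // t < q n ∨ q n = finalTime T} => max (x n i) 0)
    ⟨0, by rintro _ ⟨m, rfl⟩; exact le_max_right _ _⟩ ⟨n, hn⟩

theorem le_regValue_of_forall (hq0 : q 0 = finalTime T) (x : ℕ → Fin k → ℝ) {t : Time T}
    (i : Fin k) {c : ℝ} (h : ∀ n, t < q n ∨ q n = finalTime T → c ≤ max (x n i) 0) :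
    c ≤ regValue q x t i :=
  have : Nonempty {n // t < q n ∨ q n = finalTime T} := ⟨0, Or.inr hq0⟩
  le_ciInf fun n => h n n.2

theorem regValue_nonneg (x : ℕ → Fin k → ℝ) (t : Time T) (i : Fin k) : 0 ≤ regValue q x t i :=
  Real.iInf_nonneg fun _ => le_max_right _ _

theorem regValue_mono (hq0 : q 0 = finalTime T) (x : ℕ → Fin k → ℝ) (i : Fin k) :
    Monotone fun t => regValue q x t i := fun _ _ hst =>
  le_regValue_of_forall hq0 x i fun _ hn => regValue_le_max x i (hn.imp_left hst.trans_lt)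

/-- An index admissible at `t` stays admissible slightly to the right of `t`, so the infimum cannot
jump up there; monotonicity gives the other bound. -/
theorem regValue_continuousWithinAt (hq0 : q 0 = finalTime T) (x : ℕ → Fin k → ℝ) (i : Fin k)
    (t : Time T) : ContinuousWithinAt (fun s => regValue q x s i) (Ici t) t := by
  have : Nonempty {n // t < q n ∨ q n = finalTime T} := ⟨0, Or.inr hq0⟩
  refine tendsto_order.2 ⟨fun b hb => ?_, fun b hb => ?_⟩
  · filter_upwards [self_mem_nhdsWithin] with s hs
    exact hb.trans_le (regValue_mono hq0 x i hs)
  · obtain ⟨⟨n, hn⟩, hnb⟩ := exists_lt_of_ciInf_lt hb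
    have h : ∀ᶠ s in 𝓝[≥] t, s < q n ∨ q n = finalTime T := by
      rcases hn with hn | hn
      · filter_upwards [mem_nhdsWithin_of_mem_nhds (Iio_mem_nhds hn)] with s hs using Or.inl hs
      · exact Eventually.of_forall fun _ => Or.inr hn
    exact h.mono fun s hs => (regValue_le_max x i hs).trans_lt hnb

/-- The right-continuous regularization of values `x n`, prescribed at times `q n`. -/
noncomputable def regPath (hq0 : q 0 = finalTime T) (x : ℕ → Fin k → ℝ) : MonotonePathSpace T k :=
  MonotonePathSpace.mk' (regValue q x) (regValue_nonneg x) (regValue_mono hq0 x)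
    (regValue_continuousWithinAt hq0 x)

theorem measurable_regPath {X : Type*} [MeasurableSpace X] (hq0 : q 0 = finalTime T)
    {x : X → ℕ → Fin k → ℝ} (hx : ∀ n i, Measurable fun ω => x ω n i) :
    Measurable fun ω => regPath hq0 (x ω) :=
  MonotonePathSpace.measurable_mk fun _ i =>
    Measurable.iInf fun n => (hx n i).max measurable_const

theorem le_regPath_of_forall (hq0 : q 0 = finalTime T) {x : ℕ → Fin k → ℝ} {t : Time T}
    {c : ℝ} {i : Fin k} (h : ∀ n, t ≤ q n → c ≤ x n i) : c ≤ (regPath hq0 x).1 t i := by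
  refine le_regValue_of_forall hq0 x i fun n hn => (h n ?_).trans (le_max_left _ _)
  rcases hn with hn | hn
  · exact hn.le
  · rw [hn]; exact le_finalTime t

/-- Prescribed values which are nonnegative and nondecreasing in time. -/
structure IsMonotoneData (q : ℕ → Time T) (x : ℕ → Fin k → ℝ) : Prop where
  nonneg : ∀ n i, 0 ≤ x n i
  mono : ∀ n m i, q n ≤ q m → x n i ≤ x m i

namespace IsMonotoneData

variable {x : ℕ → Fin k → ℝ}

theorem regPath_le (hx : IsMonotoneData q x) (hq0 : q 0 = finalTime T) {t : Time T} {n : ℕ}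
    (hn : t < q n) (i : Fin k) : (regPath hq0 x).1 t i ≤ x n i := by
  have := regValue_le_max (q := q) x i (Or.inl hn)
  rwa [max_eq_left (hx.nonneg n i)] at this

theorem le_regPath (hx : IsMonotoneData q x) (hq0 : q 0 = finalTime T) {t : Time T} {n : ℕ}
    (hn : q n ≤ t) (i : Fin k) : x n i ≤ (regPath hq0 x).1 t i :=
  le_regPath_of_forall hq0 fun _ hm => hx.mono _ _ _ (hn.trans hm)

theorem regPath_final (hx : IsMonotoneData q x) (hq0 : q 0 = finalTime T) (i : Fin k) :
    (regPath hq0 x).1 (finalTime T) i = x 0 i := by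
  refine le_antisymm ?_ (hx.le_regPath hq0 hq0.le i)
  have := regValue_le_max (q := q) x (t := finalTime T) i (Or.inr hq0)
  rwa [max_eq_left (hx.nonneg 0 i)] at this

/-- The value `x (j m)` lies between the regularized path at `t` and at `q (j m)`, and the latter
tends to the former by right-continuity. -/
theorem tendsto_regPath (hx : IsMonotoneData q x) (hq0 : q 0 = finalTime T) {t : Time T}
    {j : ℕ → ℕ} (hj : ∀ m, t < q (j m)) (hjt : Tendsto (fun m => q (j m)) atTop (𝓝 t))
    (i : Fin k) : Tendsto (fun m => x (j m) i) atTop (𝓝 ((regPath hq0 x).1 t i)) := by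
  have h : Tendsto (fun m => (regPath hq0 x).1 (q (j m)) i) atTop (𝓝 ((regPath hq0 x).1 t i)) :=
    ((regPath hq0 x).continuousWithinAt_apply t i).tendsto.comp
      (tendsto_nhdsWithin_iff.2 ⟨hjt, Eventually.of_forall fun m => (hj m).le⟩)
  exact tendsto_of_tendsto_of_tendsto_of_le_of_le tendsto_const_nhds h
    (fun m => hx.regPath_le hq0 (hj m) i) fun m => hx.le_regPath hq0 le_rfl i

end IsMonotoneData

theorem exists_seq_gt_tendsto (hq : DenseRange q) {t : Time T} (ht : t < finalTime T) :
    ∃ j : ℕ → ℕ, (∀ m, t < q (j m)) ∧ Tendsto (fun m => q (j m)) atTop (𝓝 t) := by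
  obtain ⟨u, -, hu, hut⟩ := exists_seq_strictAnti_tendsto' ht
  have h : ∀ m, ∃ j, q j ∈ Ioo t (u m) := fun m => by
    obtain ⟨_, ⟨j, rfl⟩, hj⟩ := hq.exists_between (hu m).1
    exact ⟨j, hj⟩
  choose j hj using h
  exact ⟨j, fun m => (hj m).1, tendsto_of_tendsto_of_tendsto_of_le_of_le tendsto_const_nhds hut
    (fun m => (hj m).1.le) fun m => (hj m).2.le⟩

theorem exists_denseRange_seq (T : ℝ) [Fact (0 < T)] :
    ∃ q : ℕ → Time T, q 0 = finalTime T ∧ DenseRange q := by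
  have : Nonempty (Time T) := ⟨finalTime T⟩
  refine ⟨fun n => n.casesOn (finalTime T) (TopologicalSpace.denseSeq (Time T)), rfl, ?_⟩
  refine (TopologicalSpace.denseRange_denseSeq (Time T)).mono ?_
  rintro _ ⟨n, rfl⟩
  exact ⟨n + 1, rfl⟩

theorem isMonotoneData_of_tendsto {a : ℕ → MonotonePathSpace T k} {x : ℕ → Fin k → ℝ}
    (h : ∀ j i, Tendsto (fun n => (a n).1 (q j) i) atTop (𝓝 (x j i))) : IsMonotoneData q x where
  nonneg j i := ge_of_tendsto' (h j i) fun n => (a n).nonneg _ i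
  mono j m i hjm := le_of_tendsto_of_tendsto' (h j i) (h m i) fun n => (a n).2.2.1 i hjm

theorem tendsto_path_final (hq0 : q 0 = finalTime T) {a : ℕ → MonotonePathSpace T k}
    {x : ℕ → Fin k → ℝ} (h : ∀ j i, Tendsto (fun n => (a n).1 (q j) i) atTop (𝓝 (x j i))) :
    Tendsto (fun n => (a n).1 (finalTime T)) atTop (𝓝 ((regPath hq0 x).1 (finalTime T))) := by
  refine tendsto_euclideanSpace_iff.2 fun i => ?_
  rw [(isMonotoneData_of_tendsto h).regPath_final hq0, ← hq0]
  exact h 0 i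

/-- Helly's argument: by monotonicity `a n` at `t` is squeezed between its values at points of `q`
on either side of `t`, and continuity of the limit path makes the limits of those bounds close. -/
theorem tendsto_path_of_continuousAt (hq0 : q 0 = finalTime T) (hq : DenseRange q)
    {a : ℕ → MonotonePathSpace T k} {x : ℕ → Fin k → ℝ}
    (h : ∀ j i, Tendsto (fun n => (a n).1 (q j) i) atTop (𝓝 (x j i))) {t : Time T}
    (h0 : initialTime T < t) (h1 : t < finalTime T) {i : Fin k}
    (hc : ContinuousAt (fun s => (regPath hq0 x).1 s i) t) :
    Tendsto (fun n => (a n).1 t i) atTop (𝓝 ((regPath hq0 x).1 t i)) := by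
  have hx := isMonotoneData_of_tendsto h
  refine tendsto_order.2 ⟨fun c hct => ?_, fun c hct => ?_⟩
  · obtain ⟨l, hl, hlt⟩ := exists_Ioc_subset_of_mem_nhds (hc.eventually_const_lt hct) ⟨_, h0⟩
    obtain ⟨m, hm, hmt⟩ := exists_between hl
    obtain ⟨_, ⟨j, rfl⟩, hj⟩ := hq.exists_between hmt
    have h2 : c < x j i :=
      (show c < _ from hlt ⟨hm, hmt.le⟩).trans_le (hx.regPath_le hq0 hj.1 i)
    exact ((h j i).eventually_const_lt h2).mono fun n hn => hn.trans_le ((a n).2.2.1 i hj.2.le)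
  · obtain ⟨u, hu, hut⟩ := exists_Ico_subset_of_mem_nhds (hc.eventually_lt_const hct) ⟨_, h1⟩
    obtain ⟨m, hm, hmt⟩ := exists_between hu
    obtain ⟨_, ⟨j, rfl⟩, hj⟩ := hq.exists_between hm
    have h2 : x j i < c :=
      (hx.le_regPath hq0 hj.2.le i).trans_lt (show _ < c from hut ⟨hm.le, hmt⟩)
    exact ((h j i).eventually_lt_const h2).mono fun n hn => ((a n).2.2.1 i hj.1.le).trans_lt hn

theorem lebesgue_countable {T : ℝ} {s : Set (Time T)} (hs : s.Countable) : lebesgue T s = 0 := by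
  rw [lebesgue, comap_subtype_coe_apply measurableSet_Icc]
  exact (hs.image _).measure_zero _

/-- A monotone function has at most countably many discontinuities. The endpoints are discarded too,
since the squeeze needs points of `q` on both sides. -/
theorem ae_tendsto_path (hq0 : q 0 = finalTime T) (hq : DenseRange q)
    {a : ℕ → MonotonePathSpace T k} {x : ℕ → Fin k → ℝ}
    (h : ∀ j i, Tendsto (fun n => (a n).1 (q j) i) atTop (𝓝 (x j i))) :
    ∀ᵐ t ∂(lebesgue T), Tendsto (fun n => (a n).1 t) atTop (𝓝 ((regPath hq0 x).1 t)) := by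
  have h0 : ∀ᵐ t ∂(lebesgue T), t ≠ initialTime T := lebesgue_countable <| by
    simp
  have h1 : ∀ᵐ t ∂(lebesgue T), t ≠ finalTime T := lebesgue_countable <| by
    simp
  have h2 : ∀ᵐ t ∂(lebesgue T), ∀ i, ContinuousAt (fun s => (regPath hq0 x).1 s i) t :=
    ae_all_iff.2 fun i =>
      lebesgue_countable ((regPath hq0 x).2.2.1 i).countable_not_continuousAt
  filter_upwards [h0, h1, h2] with t ht0 ht1 ht2
  exact tendsto_euclideanSpace_iff.2 fun i => tendsto_path_of_continuousAt hq0 hq h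
    (lt_of_le_of_ne (initialTime_le t) ht0.symm) (lt_of_le_of_ne (le_finalTime t) ht1) (ht2 i)

end Regularization

/-! ### Adapted controls and strong admissibility -/

section Controls

/-- `σ(l_u ; u ≤ s)` on the Skorokhod space. -/
abbrev pathSigma (T : ℝ) (d : ℕ) (s : ℝ) : MeasurableSpace (SkorokhodSpace T d) :=
  ⨆ u : Time T, ⨆ _ : (u : ℝ) ≤ s,
    MeasurableSpace.comap (fun l : SkorokhodSpace T d => l.1 u) inferInstance

/-- `⋂_{s > t} σ(l_u ; u ≤ s)` on the Skorokhod space. -/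
abbrev pathSigmaPlus (T : ℝ) (d : ℕ) (t : ℝ) : MeasurableSpace (SkorokhodSpace T d) :=
  ⨅ s : ℝ, ⨅ _ : t < s, pathSigma T d s

/-- The completion of `⋂_{s > t} σ(l_u ; u ≤ s)` by the `P₀`-negligible sets. -/
abbrev completedSigma {T : ℝ} {d : ℕ} (P₀ : Measure (SkorokhodSpace T d)) (t : ℝ) :
    MeasurableSpace (SkorokhodSpace T d) :=
  eventuallyMeasurableSpace (pathSigmaPlus T d t) (ae P₀)

theorem pathSigma_le (T : ℝ) (d : ℕ) (s : ℝ) :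
    pathSigma T d s ≤ (inferInstance : MeasurableSpace (SkorokhodSpace T d)) :=
  iSup₂_le fun u _ => (SkorokhodSpace.measurable_eval u).comap_le

theorem pathSigma_mono (T : ℝ) (d : ℕ) {s t : ℝ} (hst : s ≤ t) :
    pathSigma T d s ≤ pathSigma T d t :=
  iSup₂_le fun u hu => le_iSup₂_of_le u (hu.trans hst) le_rfl

theorem pathSigmaPlus_le_pathSigma (T : ℝ) (d : ℕ) {t s : ℝ} (h : t < s) :
    pathSigmaPlus T d t ≤ pathSigma T d s :=
  iInf₂_le s h

theorem pathSigmaPlus_mono (T : ℝ) (d : ℕ) {s t : ℝ} (hst : s ≤ t) :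
    pathSigmaPlus T d s ≤ pathSigmaPlus T d t :=
  le_iInf₂ fun _ hu => pathSigmaPlus_le_pathSigma T d (hst.trans_lt hu)

theorem eventuallyMeasurableSpace_mono {X : Type*} {m m' : MeasurableSpace X} (h : m ≤ m')
    (F : Filter X) [CountableInterFilter F] :
    eventuallyMeasurableSpace m F ≤ eventuallyMeasurableSpace m' F :=
  fun _ ⟨t, ht, hst⟩ => ⟨t, h _ ht, hst⟩

/-- A σ-algebra-decreasing intersection commutes with the completion by negligible sets. -/
theorem iInf_completion_le {T : ℝ} {d : ℕ} (P₀ : Measure (SkorokhodSpace T d)) (t : ℝ)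
    {S : Set (SkorokhodSpace T d)}
    (hS : ∀ s, t < s → MeasurableSet[eventuallyMeasurableSpace (pathSigma T d s) (ae P₀)] S) :
    MeasurableSet[completedSigma P₀ t] S := by
  have hpos : ∀ m : ℕ, t < t + 1 / ((m : ℝ) + 1) := fun m => by
    have : (0 : ℝ) < 1 / ((m : ℝ) + 1) := by positivity
    linarith
  choose B hB hSB using fun m : ℕ => hS _ (hpos m)
  have hanti : ∀ m n : ℕ, m ≤ n → t + 1 / ((n : ℝ) + 1) ≤ t + 1 / ((m : ℝ) + 1) :=
    fun m n hmn => by gcongr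
  -- The upper limit of the approximating sets depends only on the tail of the sequence, so it lies
  -- in `pathSigma T d s` for every `s > t`; each `B m` differs from `S` by a null set, hence so
  -- does the upper limit.
  refine ⟨⋂ m, ⋃ n, B (m + n), ?_, ?_⟩
  · refine (MeasurableSpace.measurableSet_iInf).2 fun s => MeasurableSpace.measurableSet_iInf.2
      fun hs => ?_
    obtain ⟨N, hN⟩ := exists_nat_one_div_lt (sub_pos.2 hs)
    have h1 : ⋂ m, ⋃ n, B (m + n) = ⋂ m, ⋃ n, B (N + m + n) := by
      refine Subset.antisymm (subset_iInter fun m => iInter_subset _ _) (subset_iInter fun m => ?_)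
      refine (iInter_subset _ m).trans (iUnion_subset fun n => ?_)
      refine subset_iUnion_of_subset (N + n) ?_
      rw [show m + (N + n) = N + m + n by ring]
    rw [h1]
    refine MeasurableSet.iInter fun m => MeasurableSet.iUnion fun n => ?_
    refine pathSigma_mono T d ?_ _ (hB (N + m + n))
    refine (hanti N _ (by omega)).trans ?_
    linarith
  · have h2 : (⋂ m, ⋃ n, S : Set (SkorokhodSpace T d)) =ᵐ[P₀] ⋂ m, ⋃ n, B (m + n) :=
      Filter.EventuallyEq.countable_iInter fun m =>
        Filter.EventuallyEq.countable_iUnion fun n : ℕ => hSB (m + n)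
    simpa [iInter_const, iUnion_const] using h2

variable {T : ℝ} [hT : Fact (0 < T)] {d k : ℕ}

theorem comap_fst_pathSigma (s : ℝ) :
    (pathSigma T d s).comap (Prod.fst : PathSpace T d k → SkorokhodSpace T d) =
      sigmaL T d k s := by
  simp only [MeasurableSpace.comap_iSup, MeasurableSpace.comap_comp]
  rfl

theorem measurable_fst_pathSigmaPlus (t : ℝ) :
    Measurable[sigmaLPlus T d k t, pathSigmaPlus T d t]
      (Prod.fst : PathSpace T d k → SkorokhodSpace T d) := by
  rw [measurable_iff_comap_le]
  refine le_iInf₂ fun s hs => ?_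
  rw [← comap_fst_pathSigma]
  exact MeasurableSpace.comap_mono (pathSigmaPlus_le_pathSigma T d hs)

theorem sigmaL_le (s : ℝ) :
    sigmaL T d k s ≤ (inferInstance : MeasurableSpace (PathSpace T d k)) := by
  rw [← comap_fst_pathSigma]
  exact (MeasurableSpace.comap_mono (pathSigma_le T d s)).trans measurable_fst.comap_le

theorem sigmaLPlus_le (t : ℝ) :
    sigmaLPlus T d k t ≤ (inferInstance : MeasurableSpace (PathSpace T d k)) :=
  (iInf₂_le (t + 1) (by linarith)).trans (sigmaL_le _)

theorem sigmaA_le (s : ℝ) :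
    sigmaA T d k s ≤ (inferInstance : MeasurableSpace (PathSpace T d k)) :=
  iSup₂_le fun u _ => ((MonotonePathSpace.measurable_eval u).comp measurable_snd).comap_le

/-- Controls which are adapted to the completed filtration of the target. -/
structure IsControl (P₀ : Measure (SkorokhodSpace T d))
    (A : SkorokhodSpace T d → MonotonePathSpace T k) : Prop where
  measurable : Measurable A
  adapted : ∀ (t : Time T) i, Measurable[completedSigma P₀ t] fun l => (A l).1 t i

variable {P₀ : Measure (SkorokhodSpace T d)} {A : SkorokhodSpace T d → MonotonePathSpace T k}

theorem IsControl.measurable_graph (hA : IsControl P₀ A) : Measurable fun l => (l, A l) :=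
  measurable_id.prodMk hA.measurable

theorem IsControl.map_fst (hA : IsControl P₀ A) :
    (P₀.map fun l => (l, A l)).map Prod.fst = P₀ := by
  rw [Measure.map_map measurable_fst hA.measurable_graph]
  exact Measure.map_id

theorem IsControl.ae_snd_eq (hA : IsControl P₀ A) (t : Time T) :
    ∀ᵐ ω ∂(P₀.map fun l => (l, A l)), ω.2.1 t = (A ω.1).1 t := by
  rw [ae_map_iff hA.measurable_graph.aemeasurable]
  · exact ae_of_all _ fun _ => rfl
  · exact measurableSet_eq_fun ((MonotonePathSpace.measurable_eval t).comp measurable_snd)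
      ((MonotonePathSpace.measurable_eval t).comp (hA.measurable.comp measurable_fst))

/-- Under the law of the graph, `A` coincides almost surely with a function of `L`, so adaptedness
of the control transfers from the Skorokhod space to the product. -/
theorem IsControl.sigmaA_le (hA : IsControl P₀ A) (t : ℝ) :
    sigmaA T d k t ≤ eventuallyMeasurableSpace (sigmaLPlus T d k t)
      (ae (P₀.map fun l => (l, A l))) := by
  refine iSup₂_le fun u hu => ?_
  rw [← measurable_iff_comap_le]
  have h1 : Measurable[completedSigma P₀ u] fun l => (A l).1 u :=
    (@measurable_euclideanSpace_iff k _ (completedSigma P₀ u) _).2 (hA.adapted u)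
  intro S hS
  obtain ⟨B, hB, hSB⟩ := h1 hS
  refine ⟨Prod.fst ⁻¹' B, (measurable_fst_pathSigmaPlus t) (pathSigmaPlus_mono T d hu _ hB), ?_⟩
  have h2 : ((fun l => (A l).1 u) ⁻¹' S) =ᵐ[(P₀.map fun l => (l, A l)).map Prod.fst] B := by
    rwa [hA.map_fst]
  have h3 := ae_eq_comp measurable_fst.aemeasurable h2
  filter_upwards [h3, hA.ae_snd_eq u] with ω h3 h4
  refine Eq.trans ?_ h3
  change (ω.2.1 u ∈ S) = ((A ω.1).1 u ∈ S)
  rw [h4]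

/-- A σ-algebra contained, up to negligible sets, in the conditioning σ-algebra is conditionally
independent of every σ-algebra. -/
theorem condIndependent_of_le_eventuallyMeasurableSpace {Ω : Type*}
    {m' m₁ m₂ m0 : MeasurableSpace Ω} {P : Measure[m0] Ω} [IsProbabilityMeasure P] (hm' : m' ≤ m0)
    (hm₂ : m₂ ≤ m0) (h : m₁ ≤ eventuallyMeasurableSpace m' (ae P)) :
    CondIndependent m' m₁ m₂ P := by
  intro S₁ S₂ h₁ h₂
  obtain ⟨B, hB, hSB⟩ := h _ h₁
  have e1 : (S₁ ∩ S₂).indicator (fun _ => (1 : ℝ)) =ᵐ[P]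
      B.indicator (S₂.indicator fun _ => (1 : ℝ)) := by
    rw [indicator_indicator]
    exact indicator_ae_eq_of_ae_eq_set (hSB.inter (EventuallyEq.refl _ _))
  have e2 : S₁.indicator (fun _ => (1 : ℝ)) =ᵐ[P] B.indicator fun _ => (1 : ℝ) :=
    indicator_ae_eq_of_ae_eq_set hSB
  have hint : Integrable (S₂.indicator fun _ => (1 : ℝ)) P :=
    (integrable_const 1).indicator (hm₂ _ h₂)
  have e3 : P[B.indicator fun _ => (1 : ℝ) | m'] = B.indicator fun _ => (1 : ℝ) :=
    condExp_of_stronglyMeasurable hm' (stronglyMeasurable_const.indicator hB)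
      ((integrable_const 1).indicator (hm' _ hB))
  have e4 := condExp_congr_ae (m := m') e2
  rw [e3] at e4
  filter_upwards [condExp_congr_ae (m := m') e1, condExp_indicator hint hB, e4] with ω g1 g2 g3
  rw [g1, g2, Pi.mul_apply, g3]
  simp [indicator]

theorem IsControl.isStronglyAdmissible [IsProbabilityMeasure P₀] (hA : IsControl P₀ A) :
    IsStronglyAdmissible P₀ (P₀.map fun l => (l, A l)) := by
  have : IsProbabilityMeasure (P₀.map fun l => (l, A l)) :=
    Measure.isProbabilityMeasure_map hA.measurable_graph.aemeasurable
  exact ⟨⟨this, hA.map_fst, fun t => condIndependent_of_le_eventuallyMeasurableSpace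
    (sigmaLPlus_le _) (sigmaL_le _) (hA.sigmaA_le t)⟩, fun t S hS => hA.sigmaA_le t S hS⟩

end Controls

/-! ### Measurability and decomposition of the cost -/

section Cost

variable {T : ℝ} [hT : Fact (0 < T)] {d k : ℕ}

/-- The projection onto the orthant. -/
noncomputable def orthantProj (x : EuclideanSpace ℝ (Fin k)) : orthant k :=
  ⟨WithLp.toLp 2 fun i => max (x i) 0, fun _ => le_max_right _ _⟩

theorem orthantProj_of_mem {x : EuclideanSpace ℝ (Fin k)} (hx : x ∈ orthant k) :
    (orthantProj x : EuclideanSpace ℝ (Fin k)) = x := by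
  ext i
  exact max_eq_left (hx i)

theorem measurable_orthantProj :
    Measurable (orthantProj : EuclideanSpace ℝ (Fin k) → orthant k) :=
  Measurable.subtype_mk (measurable_euclideanSpace_iff.2 fun i =>
    (measurable_euclideanSpace_apply i).max measurable_const)

/-- An `[0,∞]`-valued extension of a function on the orthant. -/
noncomputable def orthantExt (φ : EuclideanSpace ℝ (Fin d) → EuclideanSpace ℝ (Fin k) → ℝ)
    (l : EuclideanSpace ℝ (Fin d)) (x : EuclideanSpace ℝ (Fin k)) : ℝ≥0∞ :=
  ENNReal.ofReal (φ l (orthantProj x))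

theorem orthantExt_of_mem (φ : EuclideanSpace ℝ (Fin d) → EuclideanSpace ℝ (Fin k) → ℝ)
    (l : EuclideanSpace ℝ (Fin d)) {x : EuclideanSpace ℝ (Fin k)} (hx : x ∈ orthant k) :
    orthantExt φ l x = ENNReal.ofReal (φ l x) := by
  rw [orthantExt, orthantProj_of_mem hx]

theorem measurable_orthantExt {φ : EuclideanSpace ℝ (Fin d) → EuclideanSpace ℝ (Fin k) → ℝ}
    (hφ : Measurable fun p : EuclideanSpace ℝ (Fin d) × orthant k => φ p.1 p.2) :
    Measurable fun p : EuclideanSpace ℝ (Fin d) × EuclideanSpace ℝ (Fin k) =>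
      orthantExt φ p.1 p.2 :=
  (hφ.comp (measurable_fst.prodMk (measurable_orthantProj.comp measurable_snd))).ennreal_ofReal

/-- The running cost. -/
noncomputable def CostData.runningCost (c : CostData T d k) (ω : PathSpace T d k) : ℝ≥0∞ :=
  ∫⁻ t, orthantExt c.h (ω.1.1 t) (ω.2.1 t) ∂(lebesgue T)

/-- The terminal cost. -/
noncomputable def CostData.terminalCost (c : CostData T d k) (ω : PathSpace T d k) : ℝ≥0∞ :=
  orthantExt c.g (ω.1.1 (finalTime T)) (ω.2.1 (finalTime T))

theorem CostData.cost_eq (c : CostData T d k) (ω : PathSpace T d k) :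
    c.cost ω = ENNReal.ofReal (realControlCost c.f ω.2) + c.runningCost ω + c.terminalCost ω := by
  rw [CostData.cost, CostData.runningCost, CostData.terminalCost,
    controlCost_eq_ofReal c.f_continuous c.f_mem, orthantExt_of_mem _ _ (ω.2.mem_orthant _)]
  simp_rw [fun t => orthantExt_of_mem c.h (ω.1.1 t) (ω.2.mem_orthant t)]

theorem CostData.measurable_running_uncurry (c : CostData T d k) :
    Measurable fun p : PathSpace T d k × Time T =>
      orthantExt c.h (p.1.1.1 p.2) (p.1.2.1 p.2) :=
  (measurable_orthantExt c.h_measurable).comp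
    ((SkorokhodSpace.measurable_eval_uncurry.comp
      ((measurable_fst.comp measurable_fst).prodMk measurable_snd)).prodMk
    (MonotonePathSpace.measurable_eval_uncurry.comp
      ((measurable_snd.comp measurable_fst).prodMk measurable_snd)))

theorem CostData.measurable_runningCost (c : CostData T d k) : Measurable c.runningCost :=
  c.measurable_running_uncurry.lintegral_prod_right'

theorem CostData.measurable_terminalCost (c : CostData T d k) : Measurable c.terminalCost :=
  (measurable_orthantExt c.g_measurable).comp
    (((SkorokhodSpace.measurable_eval _).comp measurable_fst).prodMk
      ((MonotonePathSpace.measurable_eval _).comp measurable_snd))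

theorem CostData.measurable_controlCost (c : CostData T d k) :
    Measurable fun ω : PathSpace T d k => ENNReal.ofReal (realControlCost c.f ω.2) :=
  ((measurable_realControlCost c.f_continuous).comp measurable_snd).ennreal_ofReal

theorem CostData.measurable_cost (c : CostData T d k) : Measurable c.cost := by
  rw [show c.cost = _ from funext c.cost_eq]
  exact (c.measurable_controlCost.add c.measurable_runningCost).add c.measurable_terminalCost

/-- Tonelli's theorem moves the time integral outside, so that Jensen's inequality can be applied at
each fixed time. -/
theorem CostData.expectedCost_eq (c : CostData T d k) (P : Measure (PathSpace T d k)) [SFinite P] :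
    c.expectedCost P = ∫⁻ ω, ENNReal.ofReal (realControlCost c.f ω.2) ∂P +
      ∫⁻ t, ∫⁻ ω, orthantExt c.h (ω.1.1 t) (ω.2.1 t) ∂P ∂(lebesgue T) +
      ∫⁻ ω, c.terminalCost ω ∂P := by
  rw [CostData.expectedCost]
  simp_rw [c.cost_eq]
  rw [lintegral_add_right _ c.measurable_terminalCost,
    lintegral_add_right _ c.measurable_runningCost]
  congr 2
  exact lintegral_lintegral_swap c.measurable_running_uncurry.aemeasurable

theorem IsControl.expectedCost_map {P₀ : Measure (SkorokhodSpace T d)}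
    {A : SkorokhodSpace T d → MonotonePathSpace T k} (hA : IsControl P₀ A) (c : CostData T d k) :
    c.expectedCost (P₀.map fun l => (l, A l)) = ∫⁻ l, c.cost (l, A l) ∂P₀ :=
  lintegral_map c.measurable_cost hA.measurable_graph

end Cost

/-! ### Conditional independence and conditional expectations -/

section ConditionalExpectation

variable {Ω : Type*} {m' m₁ m₂ m0 : MeasurableSpace Ω} {P : Measure[m0] Ω}

/-- Test against `B` in `m₂`: the integral of `P(S | m')` over `B` equals that of `P(B | m') P(S |
m')`, which by conditional independence is the integral of `P(S ∩ B | m')`, that is `P(S ∩ B)`. -/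
theorem condExp_indicator_eq_of_condIndependent [IsProbabilityMeasure P] (hm' : m' ≤ m₂)
    (hm₁ : m₁ ≤ m0) (hm₂ : m₂ ≤ m0) (h : CondIndependent m' m₁ m₂ P) {S : Set Ω}
    (hS : MeasurableSet[m₁] S) :
    P[S.indicator fun _ => (1 : ℝ) | m₂] =ᵐ[P] P[S.indicator fun _ => (1 : ℝ) | m'] := by
  have hm'0 := hm'.trans hm₂
  have hint : ∀ B : Set Ω, MeasurableSet[m0] B → Integrable (B.indicator fun _ => (1 : ℝ)) P :=
    fun B hB => (integrable_const 1).indicator hB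
  refine (ae_eq_condExp_of_forall_setIntegral_eq hm₂ (hint S (hm₁ _ hS))
    (fun _ _ _ => integrable_condExp.integrableOn) (fun B hB _ => ?_)
    (stronglyMeasurable_condExp.mono hm').aestronglyMeasurable).symm
  have hB0 := hm₂ _ hB
  set g := P[S.indicator fun _ => (1 : ℝ) | m'] with hg
  have e0 : (B.indicator fun _ => (1 : ℝ)) * g = B.indicator g := by
    ext ω
    by_cases hω : ω ∈ B <;> simp [hω]
  have e1 : P[(B.indicator fun _ => (1 : ℝ)) * g | m'] =ᵐ[P]
      P[B.indicator fun _ => (1 : ℝ) | m'] * g :=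
    condExp_mul_of_stronglyMeasurable_right stronglyMeasurable_condExp
      (by rw [e0]; exact integrable_condExp.indicator hB0) (hint B hB0)
  calc ∫ ω in B, g ω ∂P = ∫ ω, ((B.indicator fun _ => (1 : ℝ)) * g) ω ∂P := by
        rw [e0, integral_indicator hB0]
    _ = ∫ ω, (P[B.indicator fun _ => (1 : ℝ) | m'] * g) ω ∂P := by
        rw [← integral_condExp hm'0, integral_congr_ae e1]
    _ = ∫ ω, (P[(S ∩ B).indicator fun _ => (1 : ℝ) | m']) ω ∂P := by
        refine integral_congr_ae ?_
        filter_upwards [h S B hS hB] with ω hω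
        rw [hω, Pi.mul_apply, Pi.mul_apply, mul_comm]
    _ = ∫ ω in B, S.indicator (fun _ => (1 : ℝ)) ω ∂P := by
        rw [integral_condExp hm'0, ← integral_indicator hB0, indicator_indicator, inter_comm]

/-- If `m₁` and `m₂` are conditionally independent given `m' ≤ m₂`, then conditioning an
`m₁`-measurable function on `m₂` is the same as conditioning it on `m'`. -/
theorem condExp_eq_of_condIndependent [IsProbabilityMeasure P] (hm' : m' ≤ m₂)
    (hm₁ : m₁ ≤ m0) (hm₂ : m₂ ≤ m0) (h : CondIndependent m' m₁ m₂ P) {f : Ω → ℝ}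
    (hf : StronglyMeasurable[m₁] f) (hint : Integrable f P) : P[f | m₂] =ᵐ[P] P[f | m'] := by
  have hm'0 := hm'.trans hm₂
  refine MemLp.induction_stronglyMeasurable hm₁ ENNReal.one_ne_top
    (fun f => P[f | m₂] =ᵐ[P] P[f | m']) ?_ ?_ ?_ ?_ (memLp_one_iff_integrable.2 hint)
    hf.aestronglyMeasurable
  · intro c S hS _
    have e : (S.indicator fun _ => c) = c • S.indicator fun _ => (1 : ℝ) := by
      ext ω
      by_cases hω : ω ∈ S <;> simp [hω]
    rw [e]
    filter_upwards [condExp_smul (μ := P) c (S.indicator fun _ => (1 : ℝ)) m₂,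
      condExp_smul (μ := P) c (S.indicator fun _ => (1 : ℝ)) m',
      condExp_indicator_eq_of_condIndependent hm' hm₁ hm₂ h hS] with ω h1 h2 h3
    rw [h1, h2, Pi.smul_apply, Pi.smul_apply, h3]
  · intro u v _ hu hv _ _ hu' hv'
    rw [memLp_one_iff_integrable] at hu hv
    exact (condExp_add hu hv m₂).trans ((hu'.add hv').trans (condExp_add hu hv m').symm)
  -- Both conditional expectations are continuous on L¹, so the set where they agree is closed.
  · have hc : {f : lpMeas ℝ ℝ m₁ 1 P | P[((f : Lp ℝ 1 P) : Ω → ℝ) | m₂] =ᵐ[P]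
        P[((f : Lp ℝ 1 P) : Ω → ℝ) | m']} =
        {f : lpMeas ℝ ℝ m₁ 1 P | condExpL1CLM ℝ hm₂ P f = condExpL1CLM ℝ hm'0 P f} := by
      ext u
      have hu : Integrable ((u : Lp ℝ 1 P) : Ω → ℝ) P := memLp_one_iff_integrable.1 (Lp.memLp _)
      have h1 := condExp_ae_eq_condExpL1CLM hm₂ hu
      have h2 := condExp_ae_eq_condExpL1CLM hm'0 hu
      rw [Integrable.toL1_coeFn] at h1 h2
      simp only [mem_ofPred]
      rw [Lp.ext_iff]
      exact ⟨fun hh => h1.symm.trans (hh.trans h2), fun hh => h1.trans (hh.trans h2.symm)⟩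
    rw [hc]
    exact isClosed_eq
      ((condExpL1CLM ℝ hm₂ P).continuous.comp (Submodule.subtypeL _).continuous)
      ((condExpL1CLM ℝ hm'0 P).continuous.comp (Submodule.subtypeL _).continuous)
  · intro u v huv _ hu
    exact (condExp_congr_ae huv.symm).trans (hu.trans (condExp_congr_ae huv))

end ConditionalExpectation

/-! ### Jensen's inequality on the orthant -/

section Jensen

variable {d k : ℕ}

/-- Jensen's inequality for a lower semicontinuous convex function on the orthant. -/
theorem orthantExt_integral_le
    {φ : EuclideanSpace ℝ (Fin d) → EuclideanSpace ℝ (Fin k) → ℝ}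
    (hφ : Measurable fun p : EuclideanSpace ℝ (Fin d) × orthant k => φ p.1 p.2)
    (h0 : ∀ l, ∀ a ∈ orthant k, 0 ≤ φ l a) (hc : ∀ l, ConvexOn ℝ (orthant k) (φ l))
    (hl : ∀ l, LowerSemicontinuousOn (φ l) (orthant k)) (l : EuclideanSpace ℝ (Fin d))
    (μ : Measure (EuclideanSpace ℝ (Fin k))) [IsProbabilityMeasure μ]
    (hμ : ∀ᵐ x ∂μ, x ∈ orthant k) (hint : Integrable (fun x => x) μ) :
    orthantExt φ l (∫ x, x ∂μ) ≤ ∫⁻ x, orthantExt φ l x ∂μ := by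
  by_cases htop : ∫⁻ x, orthantExt φ l x ∂μ = ∞
  · rw [htop]; exact le_top
  have hmeas : Measurable fun x : EuclideanSpace ℝ (Fin k) => φ l (orthantProj x) :=
    hφ.comp (measurable_const.prodMk measurable_orthantProj)
  have hnn : ∀ x : EuclideanSpace ℝ (Fin k), 0 ≤ φ l (orthantProj x) :=
    fun x => h0 l _ (orthantProj x).2
  have hφint : Integrable (fun x => φ l (orthantProj x)) μ :=
    (lintegral_ofReal_ne_top_iff_integrable hmeas.aestronglyMeasurable (ae_of_all _ hnn)).1 htop
  -- The epigraph is convex, and closed by lower semicontinuity, so it contains the mean of the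
  -- points `(x, φ l x)`.
  have hclosed := (lowerSemicontinuousOn_iff_isClosed_epigraph isClosed_orthant).1 (hl l)
  have hmem := (hc l).convex_epigraph.integral_mem (μ := μ) hclosed
    (f := fun x => (x, φ l (orthantProj x)))
    (by
      filter_upwards [hμ] with x hx
      exact ⟨hx, by rw [orthantProj_of_mem hx]⟩) (hint.prodMk hφint)
  rw [integral_pair hint hφint] at hmem
  change (∫ x, x ∂μ) ∈ orthant k ∧ φ l (∫ x, x ∂μ) ≤ ∫ x, φ l (orthantProj x) ∂μ at hmem
  rw [orthantExt_of_mem _ _ hmem.1]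
  refine (ENNReal.ofReal_le_ofReal hmem.2).trans_eq ?_
  exact ofReal_integral_eq_lintegral_ofReal hφint (ae_of_all _ hnn)

end Jensen

/-! ### The mean control cost as a function of the mean path -/

section MeanControlCost

open Polynomial

variable {T : ℝ} [hT : Fact (0 < T)] {k : ℕ} {X : Type*} [MeasurableSpace X] {μ : Measure X}
  {A : X → MonotonePathSpace T k}

theorem integrable_path_of_final (hA : Measurable A) {i : Fin k}
    (hint : Integrable (fun x => (A x).1 (finalTime T) i) μ) (t : Time T) :
    Integrable (fun x => (A x).1 t i) μ := by
  refine hint.mono' (((measurable_euclideanSpace_apply i).comp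
    ((MonotonePathSpace.measurable_eval t).comp hA)).aestronglyMeasurable)
    (ae_of_all _ fun x => ?_)
  rw [Real.norm_of_nonneg ((A x).nonneg t i)]
  exact (A x).le_final t i

theorem integrable_realControlCost (hA : Measurable A)
    (hint : ∀ i, Integrable (fun x => (A x).1 (finalTime T) i) μ)
    {f : Time T → EuclideanSpace ℝ (Fin k)} (hf : Continuous f) :
    Integrable (fun x => realControlCost f (A x)) μ := by
  have : CompactSpace (Time T) := isCompact_iff_compactSpace.1 isCompact_Icc
  obtain ⟨C, hC⟩ := isCompact_univ.exists_bound_of_continuousOn hf.continuousOn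
  refine ((integrable_finsetSum Finset.univ fun i _ => hint i).const_mul C).mono'
    ((measurable_realControlCost hf).comp hA).aestronglyMeasurable (ae_of_all _ fun x => ?_)
  -- The zero polynomial has zero cost, so the approximation bound, with `C` a bound for `f`,
  -- dominates the control cost itself.
  have := abs_polyControlCost_sub_le hf (p := fun _ => 0) (ε := C) (fun i t => ?_) (A x)
  · simpa [polyControlCost] using this
  · rw [eval_zero, zero_sub, abs_neg]
    exact (PiLp.norm_apply_le (f t) i).trans (hC t (mem_univ t))

/-- Fubini's theorem in the integration-by-parts formula leaves only the means of the path values.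
-/
theorem integral_polyControlCost [IsFiniteMeasure μ] (hA : Measurable A)
    (hint : ∀ i, Integrable (fun x => (A x).1 (finalTime T) i) μ) (p : Fin k → ℝ[X]) :
    Integrable (fun x => polyControlCost p (A x)) μ ∧ ∫ x, polyControlCost p (A x) ∂μ =
      ∑ i, ((p i).eval T * ∫ x, (A x).1 (finalTime T) i ∂μ -
        ∫ s, (p i).derivative.eval (s : ℝ) * ∫ x, (A x).1 s i ∂μ ∂(lebesgue T)) := by
  have h1 : ∀ i, Integrable (Function.uncurry fun (x : X) (s : Time T) =>
      (p i).derivative.eval (s : ℝ) * (A x).1 s i) (μ.prod (lebesgue T)) := by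
    intro i
    obtain ⟨C, hC⟩ := exists_norm_eval_le (T := T) (p i).derivative
    refine (((hint i).comp_fst (lebesgue T)).const_mul C).mono' ?_ (ae_of_all _ ?_)
    · exact (((continuous_eval_time _).measurable.comp measurable_snd).mul
        ((measurable_euclideanSpace_apply i).comp
          (MonotonePathSpace.measurable_eval_uncurry.comp
            ((hA.comp measurable_fst).prodMk measurable_snd)))).aestronglyMeasurable
    · rintro ⟨x, s⟩
      simp only [Function.uncurry]
      rw [norm_mul, Real.norm_of_nonneg ((A x).nonneg s i)]
      exact mul_le_mul (hC s) ((A x).le_final s i) ((A x).nonneg s i)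
        ((norm_nonneg _).trans (hC s))
  have h2 : ∀ i, Integrable (fun x => ∫ s, (p i).derivative.eval (s : ℝ) * (A x).1 s i
      ∂(lebesgue T)) μ := fun i => (h1 i).integral_prod_left
  have h3 : ∀ i, Integrable (fun x => (p i).eval T * (A x).1 (finalTime T) i -
      ∫ s, (p i).derivative.eval (s : ℝ) * (A x).1 s i ∂(lebesgue T)) μ :=
    fun i => ((hint i).const_mul _).sub (h2 i)
  refine ⟨integrable_finsetSum _ fun i _ => h3 i, ?_⟩
  simp only [polyControlCost]
  rw [integral_finsetSum _ fun i _ => h3 i]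
  refine Finset.sum_congr rfl fun i _ => ?_
  rw [integral_sub ((hint i).const_mul _) (h2 i), integral_const_mul,
    integral_integral_swap (h1 i)]
  simp_rw [integral_const_mul]

theorem tendsto_integral_polyControlCost [IsFiniteMeasure μ] (hA : Measurable A)
    (hint : ∀ i, Integrable (fun x => (A x).1 (finalTime T) i) μ)
    {f : Time T → EuclideanSpace ℝ (Fin k)} (hf : Continuous f) {p : ℕ → Fin k → ℝ[X]}
    (hp : ∀ n i (t : Time T), |(p n i).eval (t : ℝ) - f t i| ≤ 1 / ((n : ℝ) + 1)) :
    Tendsto (fun n => ∫ x, polyControlCost (p n) (A x) ∂μ) atTop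
      (𝓝 (∫ x, realControlCost f (A x) ∂μ)) := by
  have hR := integrable_realControlCost hA hint hf
  have hS := integrable_finsetSum Finset.univ fun i _ => hint i
  rw [tendsto_iff_norm_sub_tendsto_zero]
  refine squeeze_zero (fun _ => norm_nonneg _) (fun n => ?_)
    (g := fun n : ℕ => 1 / ((n : ℝ) + 1) * ∫ x, ∑ i, (A x).1 (finalTime T) i ∂μ) ?_
  · rw [← integral_sub (integral_polyControlCost hA hint (p n)).1 hR, ← integral_const_mul]
    refine norm_integral_le_of_norm_le (hS.const_mul _) (ae_of_all _ fun x => ?_)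
    exact abs_polyControlCost_sub_le hf (hp n) (A x)
  · simpa using (tendsto_one_div_add_atTop_nhds_zero_nat (𝕜 := ℝ)).mul_const
      (∫ x, ∑ i, (A x).1 (finalTime T) i ∂μ)

/-- The mean control cost depends only on the mean path. -/
theorem lintegral_realControlCost_congr [IsFiniteMeasure μ] {Y : Type*} [MeasurableSpace Y]
    {ν : Measure Y} [IsFiniteMeasure ν] {B : Y → MonotonePathSpace T k} (hA : Measurable A) (hB : Measurable B)
    (hintA : ∀ i, Integrable (fun x => (A x).1 (finalTime T) i) μ)
    (hintB : ∀ i, Integrable (fun x => (B x).1 (finalTime T) i) ν)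
    (h : ∀ t i, ∫ x, (A x).1 t i ∂μ = ∫ y, (B y).1 t i ∂ν)
    {f : Time T → EuclideanSpace ℝ (Fin k)} (hf : Continuous f) (hf0 : ∀ t, f t ∈ orthant k) :
    ∫⁻ x, ENNReal.ofReal (realControlCost f (A x)) ∂μ =
      ∫⁻ y, ENNReal.ofReal (realControlCost f (B y)) ∂ν := by
  obtain ⟨p, hp⟩ := exists_polynomial_approx hf
  rw [← ofReal_integral_eq_lintegral_ofReal (integrable_realControlCost hA hintA hf)
      (ae_of_all _ fun x => realControlCost_nonneg hf0 _),
    ← ofReal_integral_eq_lintegral_ofReal (integrable_realControlCost hB hintB hf)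
      (ae_of_all _ fun x => realControlCost_nonneg hf0 _)]
  congr 1
  refine tendsto_nhds_unique (tendsto_integral_polyControlCost hA hintA hf hp) ?_
  have := tendsto_integral_polyControlCost hB hintB hf hp
  simp_rw [(integral_polyControlCost hB hintB _).2, ← h] at this
  simpa only [(integral_polyControlCost hA hintA _).2] using this

end MeanControlCost

/-! ### The conditional mean of the follower given the target -/

section Projection

variable {T : ℝ} [hT : Fact (0 < T)] {d k : ℕ}

theorem sigmaL_final_eq :
    sigmaL T d k T = MeasurableSpace.comap (Prod.fst : PathSpace T d k → SkorokhodSpace T d)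
      inferInstance := by
  rw [← comap_fst_pathSigma]
  congr 1
  refine le_antisymm (pathSigma_le T d T) ?_
  rw [show (inferInstance : MeasurableSpace (SkorokhodSpace T d)) =
    MeasurableSpace.comap Subtype.val MeasurableSpace.pi from rfl, MeasurableSpace.pi,
    MeasurableSpace.comap_iSup]
  refine iSup_le fun u => ?_
  rw [MeasurableSpace.comap_comp]
  exact le_iSup₂_of_le u u.2.2 le_rfl

/-- The zero path. -/
noncomputable def zeroPath (T : ℝ) [Fact (0 < T)] (k : ℕ) : MonotonePathSpace T k :=
  MonotonePathSpace.mk' (fun _ _ => 0) (fun _ _ => le_rfl) (fun _ => monotone_const)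
    fun _ _ => continuousWithinAt_const

theorem measurable_zeroPath_section_pathSigma (s : ℝ) :
    Measurable[pathSigma T d s, sigmaL T d k s] fun l => (l, zeroPath T k) := by
  rw [← comap_fst_pathSigma, measurable_iff_comap_le, MeasurableSpace.comap_comp]
  exact MeasurableSpace.comap_id.le

/-- Composition with this section carries functions measurable for `sigmaLPlus` to functions on the
Skorokhod space. It spares a comparison of the intersection of the pulled-back σ-algebras with the
pull-back of their intersection. -/
theorem measurable_zeroPath_section (t : ℝ) :
    Measurable[pathSigmaPlus T d t, sigmaLPlus T d k t] fun l => (l, zeroPath T k) := by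
  intro S hS
  refine MeasurableSpace.measurableSet_iInf.2 fun s => MeasurableSpace.measurableSet_iInf.2
    fun hs => measurable_zeroPath_section_pathSigma s ?_
  exact MeasurableSpace.measurableSet_iInf.1 (MeasurableSpace.measurableSet_iInf.1 hS s) hs

/-- Each level set of `Z` is the preimage of a set of target paths, so `Z` does not see the
follower. -/
theorem eq_comp_section_of_measurable {t : ℝ} {Z : PathSpace T d k → ℝ}
    (hZ : Measurable[sigmaLPlus T d k t] Z) (ω : PathSpace T d k) :
    Z ω = Z (ω.1, zeroPath T k) := by
  have h1 : MeasurableSet[sigmaL T d k (t + 1)] (Z ⁻¹' {Z ω}) :=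
    (iInf₂_le (t + 1) (by linarith) : sigmaLPlus T d k t ≤ _) _ (hZ (measurableSet_singleton _))
  rw [← comap_fst_pathSigma] at h1
  obtain ⟨B, -, hB⟩ := h1
  have h2 : ω ∈ Prod.fst ⁻¹' B := hB ▸ rfl
  have h3 : (ω.1, zeroPath T k) ∈ Z ⁻¹' {Z ω} := hB ▸ h2
  exact h3.symm

variable {P₀ : Measure (SkorokhodSpace T d)} {P : Measure (PathSpace T d k)}

theorem IsAdmissible.ae_of_ae_fst (hP : IsAdmissible P₀ P) {p : SkorokhodSpace T d → Prop}
    (hp : MeasurableSet {l | p l}) (h : ∀ᵐ ω ∂P, p ω.1) : ∀ᵐ l ∂P₀, p l := by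
  rw [← hP.marginal]
  exact (ae_map_iff measurable_fst.aemeasurable hp).2 h

theorem IsAdmissible.integral_fst (hP : IsAdmissible P₀ P) {f : SkorokhodSpace T d → ℝ}
    (hf : Measurable f) : ∫ ω, f ω.1 ∂P = ∫ l, f l ∂P₀ := by
  rw [← hP.marginal, integral_map measurable_fst.aemeasurable hf.aestronglyMeasurable]

theorem measurable_eval_snd (t : Time T) :
    Measurable fun ω : PathSpace T d k => ω.2.1 t :=
  (MonotonePathSpace.measurable_eval t).comp measurable_snd

theorem integrable_final_of_expectedTotal (h : expectedTotal P ≠ ∞) (i : Fin k) :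
    Integrable (fun ω : PathSpace T d k => ω.2.1 (finalTime T) i) P := by
  refine Integrable.mono (g := fun ω : PathSpace T d k => ω.2.1 (finalTime T))
    ⟨(measurable_eval_snd _).aestronglyMeasurable, h.lt_top⟩
    ((measurable_euclideanSpace_apply i).comp (measurable_eval_snd _)).aestronglyMeasurable
    (ae_of_all _ fun ω => PiLp.norm_apply_le _ i)

theorem integrable_of_expectedTotal (h : expectedTotal P ≠ ∞) (t : Time T) (i : Fin k) :
    Integrable (fun ω : PathSpace T d k => ω.2.1 t i) P :=
  integrable_path_of_final measurable_snd (integrable_final_of_expectedTotal h i) t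

theorem integrable_vector_of_expectedTotal (h : expectedTotal P ≠ ∞) (t : Time T) :
    Integrable (fun ω : PathSpace T d k => ω.2.1 t) P := by
  refine Integrable.mono (g := fun ω : PathSpace T d k => ω.2.1 (finalTime T))
    ⟨(measurable_eval_snd _).aestronglyMeasurable, h.lt_top⟩
    (measurable_eval_snd t).aestronglyMeasurable (ae_of_all _ fun ω => ?_)
  rw [EuclideanSpace.norm_eq, EuclideanSpace.norm_eq]
  refine Real.sqrt_le_sqrt (Finset.sum_le_sum fun i _ => ?_)
  rw [Real.norm_of_nonneg (ω.2.nonneg _ i), Real.norm_of_nonneg (ω.2.nonneg _ i)]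
  exact pow_le_pow_left₀ (ω.2.nonneg _ i) (ω.2.le_final t i) 2

/-- The conditional mean, given the target, of the `i`-th coordinate of the follower at time `t`. -/
noncomputable def condMean (P : Measure (PathSpace T d k)) [IsFiniteMeasure P] (t : Time T)
    (i : Fin k) (l : SkorokhodSpace T d) : ℝ :=
  ∫ x, x i ∂(ProbabilityTheory.condDistrib (fun ω : PathSpace T d k => ω.2.1 t) Prod.fst P l)

variable [IsFiniteMeasure P]

theorem measurable_condMean (t : Time T) (i : Fin k) : Measurable (condMean P t i) :=
  (StronglyMeasurable.integral_kernel
    (measurable_euclideanSpace_apply i).stronglyMeasurable).measurable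

theorem condExp_ae_eq_condMean (h : expectedTotal P ≠ ∞) (t : Time T) (i : Fin k) :
    P[fun ω => ω.2.1 t i | MeasurableSpace.comap Prod.fst inferInstance] =ᵐ[P]
      fun ω => condMean P t i ω.1 :=
  ProbabilityTheory.condExp_ae_eq_integral_condDistrib measurable_fst
    (measurable_eval_snd t).aemeasurable (measurable_euclideanSpace_apply i).stronglyMeasurable
    (integrable_of_expectedTotal h t i)

theorem IsAdmissible.integrable_condMean (hP : IsAdmissible P₀ P) (h : expectedTotal P ≠ ∞)
    (t : Time T) (i : Fin k) : Integrable (condMean P t i) P₀ := by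
  rw [← hP.marginal, integrable_map_measure (measurable_condMean t i).aestronglyMeasurable
    measurable_fst.aemeasurable]
  exact integrable_condExp.congr (condExp_ae_eq_condMean h t i)

theorem IsAdmissible.integral_condMean (hP : IsAdmissible P₀ P) (h : expectedTotal P ≠ ∞)
    (t : Time T) (i : Fin k) : ∫ l, condMean P t i l ∂P₀ = ∫ ω, ω.2.1 t i ∂P := by
  rw [← hP.integral_fst (measurable_condMean t i),
    ← integral_congr_ae (condExp_ae_eq_condMean h t i), integral_condExp measurable_fst.comap_le]

theorem IsAdmissible.condMean_mono (hP : IsAdmissible P₀ P) (h : expectedTotal P ≠ ∞)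
    {s t : Time T} (hst : s ≤ t) (i : Fin k) : ∀ᵐ l ∂P₀, condMean P s i l ≤ condMean P t i l := by
  refine hP.ae_of_ae_fst (measurableSet_le (measurable_condMean s i) (measurable_condMean t i)) ?_
  filter_upwards [condExp_ae_eq_condMean h s i, condExp_ae_eq_condMean h t i,
    condExp_mono (m := MeasurableSpace.comap Prod.fst inferInstance)
      (integrable_of_expectedTotal h s i) (integrable_of_expectedTotal h t i)
      (ae_of_all _ fun ω => ω.2.2.2.1 i hst)] with ω h1 h2 h3
  rwa [← h1, ← h2]

theorem IsAdmissible.condMean_nonneg (hP : IsAdmissible P₀ P) (h : expectedTotal P ≠ ∞)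
    (t : Time T) (i : Fin k) : ∀ᵐ l ∂P₀, 0 ≤ condMean P t i l := by
  refine hP.ae_of_ae_fst (measurableSet_le measurable_const (measurable_condMean t i)) ?_
  filter_upwards [condExp_ae_eq_condMean h t i,
    condExp_nonneg (m := MeasurableSpace.comap Prod.fst inferInstance) (μ := P)
      (f := fun ω : PathSpace T d k => ω.2.1 t i) (ae_of_all _ fun ω => ω.2.nonneg t i)]
    with ω h1 h2
  rwa [← h1]

/-- The conditional mean is adapted to the completed filtration of the target. -/
theorem IsAdmissible.condMean_adapted (hP : IsAdmissible P₀ P) (h : expectedTotal P ≠ ∞)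
    (t : Time T) (i : Fin k) : Measurable[completedSigma P₀ t] (condMean P t i) := by
  have := hP.isProbabilityMeasure
  have hX : StronglyMeasurable[sigmaA T d k t] fun ω : PathSpace T d k => ω.2.1 t i := by
    refine Measurable.stronglyMeasurable ?_
    refine (measurable_euclideanSpace_apply i).comp (measurable_iff_comap_le.2 ?_)
    exact le_iSup₂_of_le t le_rfl le_rfl
  have hLT : sigmaLPlus T d k t ≤ sigmaL T d k T := by
    rw [sigmaL_final_eq]
    refine (iInf₂_le ((t : ℝ) + 1) (lt_add_one _)).trans ?_
    rw [← comap_fst_pathSigma]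
    exact MeasurableSpace.comap_mono (pathSigma_le T d _)
  -- This is where nonanticipativity enters: conditioning on the whole target reduces to
  -- conditioning on `F^L_{t+}`.
  have h1 := condExp_eq_of_condIndependent hLT (sigmaA_le _) (sigmaL_le _)
    (hP.nonanticipative t) hX (integrable_of_expectedTotal h t i)
  rw [sigmaL_final_eq] at h1
  set Z := P[fun ω : PathSpace T d k => ω.2.1 t i | sigmaLPlus T d k t] with hZdef
  have hZ : Measurable[sigmaLPlus T d k t] Z := stronglyMeasurable_condExp.measurable
  have hZ' : Measurable[pathSigmaPlus T d t] fun l => Z (l, zeroPath T k) :=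
    hZ.comp (measurable_zeroPath_section t)
  have hle : pathSigmaPlus T d t ≤ (inferInstance : MeasurableSpace (SkorokhodSpace T d)) :=
    (pathSigmaPlus_le_pathSigma T d (lt_add_one _)).trans (pathSigma_le T d _)
  have hae : ∀ᵐ l ∂P₀, condMean P t i l = Z (l, zeroPath T k) := by
    refine hP.ae_of_ae_fst (measurableSet_eq_fun (measurable_condMean t i) (hZ'.mono hle le_rfl)) ?_
    filter_upwards [condExp_ae_eq_condMean h t i, h1] with ω h2 h3
    rw [← h2, h3, ← eq_comp_section_of_measurable hZ]
  exact hZ'.eventuallyMeasurable_of_eventuallyEq hae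

/-- Jensen's inequality for the conditional mean. -/
theorem IsAdmissible.lintegral_orthantExt_condMean_le (hP : IsAdmissible P₀ P)
    (h : expectedTotal P ≠ ∞)
    {φ : EuclideanSpace ℝ (Fin d) → EuclideanSpace ℝ (Fin k) → ℝ}
    (hφ : Measurable fun p : EuclideanSpace ℝ (Fin d) × orthant k => φ p.1 p.2)
    (h0 : ∀ l, ∀ a ∈ orthant k, 0 ≤ φ l a) (hc : ∀ l, ConvexOn ℝ (orthant k) (φ l))
    (hl : ∀ l, LowerSemicontinuousOn (φ l) (orthant k)) (t : Time T) :
    ∫⁻ l, orthantExt φ (l.1 t) (WithLp.toLp 2 fun i => condMean P t i l) ∂P₀ ≤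
      ∫⁻ ω, orthantExt φ (ω.1.1 t) (ω.2.1 t) ∂P := by
  set X := fun ω : PathSpace T d k => ω.2.1 t with hX
  have hXm : Measurable X := measurable_eval_snd t
  set κ := ProbabilityTheory.condDistrib X Prod.fst P with hκ
  -- Disintegration of the law of `(L, A_t)`: Jensen's inequality is applied to the conditional law
  -- `κ l` with `l` fixed, so that `φ` may depend on `l`.
  have hcomp : P₀.compProd κ = P.map fun ω => (ω.1, X ω) := by
    rw [← hP.marginal]
    exact ProbabilityTheory.compProd_map_condDistrib hXm.aemeasurable
  have hφm := measurable_orthantExt hφ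
  have hFm : Measurable fun p : SkorokhodSpace T d × EuclideanSpace ℝ (Fin k) =>
      orthantExt φ (p.1.1 t) p.2 :=
    hφm.comp (((SkorokhodSpace.measurable_eval t).comp measurable_fst).prodMk measurable_snd)
  have : IsFiniteMeasure P₀ := by rw [← hP.marginal]; infer_instance
  have hint : ∀ᵐ l ∂P₀, Integrable (fun x => x) (κ l) := by
    have h1 : Integrable (fun p : SkorokhodSpace T d × EuclideanSpace ℝ (Fin k) => p.2)
        (P.map fun ω => (ω.1, X ω)) := by
      rw [integrable_map_measure measurable_snd.aestronglyMeasurable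
        (measurable_fst.prodMk hXm).aemeasurable]
      exact integrable_vector_of_expectedTotal h t
    have := h1.condDistrib_ae_map hXm.aemeasurable
    rwa [hP.marginal] at this
  have hsupp : ∀ᵐ l ∂P₀, ∀ᵐ x ∂(κ l), x ∈ orthant k := by
    refine Measure.ae_ae_of_ae_compProd (μ := P₀) (κ := κ)
      (p := fun p : SkorokhodSpace T d × EuclideanSpace ℝ (Fin k) => p.2 ∈ orthant k) ?_
    rw [hcomp, ae_map_iff (measurable_fst.prodMk hXm).aemeasurable
      (measurable_snd isClosed_orthant.measurableSet)]
    exact ae_of_all _ fun ω => ω.2.mem_orthant t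
  calc ∫⁻ l, orthantExt φ (l.1 t) (WithLp.toLp 2 fun i => condMean P t i l) ∂P₀
      ≤ ∫⁻ l, ∫⁻ x, orthantExt φ (l.1 t) x ∂(κ l) ∂P₀ := by
        refine lintegral_mono_ae ?_
        filter_upwards [hint, hsupp] with l h1 h2
        have h3 : (WithLp.toLp 2 fun i => condMean P t i l) = ∫ x, x ∂(κ l) := by
          ext i
          exact (EuclideanSpace.proj (𝕜 := ℝ) i).integral_comp_comm h1
        rw [h3]
        exact orthantExt_integral_le hφ h0 hc hl (l.1 t) (κ l) h2 h1
    _ = ∫⁻ p, orthantExt φ (p.1.1 t) p.2 ∂(P₀.compProd κ) :=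
        (Measure.lintegral_compProd hFm).symm
    _ = _ := by rw [hcomp, lintegral_map hFm (measurable_fst.prodMk hXm)]

end Projection

/-! ### The right-continuous projection and its cost -/

section Projection

variable {T : ℝ} [hT : Fact (0 < T)] {d k : ℕ} {q : ℕ → Time T}
  {P₀ : Measure (SkorokhodSpace T d)} {P : Measure (PathSpace T d k)}

/-- The right-continuous version of the conditional mean of the follower given the target. -/
noncomputable def meanControl (hq0 : q 0 = finalTime T) (P : Measure (PathSpace T d k))
    [IsFiniteMeasure P] (l : SkorokhodSpace T d) : MonotonePathSpace T k :=
  regPath hq0 fun n i => condMean P (q n) i l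

variable [IsFiniteMeasure P]

theorem measurable_meanControl (hq0 : q 0 = finalTime T) : Measurable (meanControl hq0 P) :=
  measurable_regPath hq0 fun n i => measurable_condMean (q n) i

theorem IsAdmissible.isMonotoneData_condMean (hP : IsAdmissible P₀ P) (h : expectedTotal P ≠ ∞)
    (q : ℕ → Time T) : ∀ᵐ l ∂P₀, IsMonotoneData q fun n i => condMean P (q n) i l := by
  have h1 : ∀ᵐ l ∂P₀, ∀ n i, 0 ≤ condMean P (q n) i l :=
    ae_all_iff.2 fun n => ae_all_iff.2 fun i => hP.condMean_nonneg h (q n) i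
  have h2 : ∀ᵐ l ∂P₀, ∀ n m i, q n ≤ q m → condMean P (q n) i l ≤ condMean P (q m) i l := by
    simp_rw [ae_all_iff]
    exact fun n m i hnm => hP.condMean_mono h hnm i
  filter_upwards [h1, h2] with l h1 h2 using ⟨h1, h2⟩

/-- The regularization is defined by times to the right of `t`, hence dominates the conditional mean
at `t`. Equality follows by comparing expectations, since `E[A_t]` is right-continuous in `t` by
dominated convergence. -/
theorem IsAdmissible.meanControl_ae_eq (hP : IsAdmissible P₀ P) (h : expectedTotal P ≠ ∞)
    (hq0 : q 0 = finalTime T) (hq : DenseRange q) (t : Time T) (i : Fin k) :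
    (fun l => (meanControl hq0 P l).1 t i) =ᵐ[P₀] condMean P t i := by
  have hdata := hP.isMonotoneData_condMean h q
  rcases (le_finalTime t).eq_or_lt with rfl | ht
  · filter_upwards [hdata] with l hl
    rw [meanControl, hl.regPath_final hq0, hq0]
  · have hAm : Measurable fun l => (meanControl hq0 P l).1 t i :=
      (measurable_euclideanSpace_apply i).comp
        ((MonotonePathSpace.measurable_eval t).comp (measurable_meanControl hq0))
    have hle : condMean P t i ≤ᵐ[P₀] fun l => (meanControl hq0 P l).1 t i := by
      have h1 : ∀ᵐ l ∂P₀, ∀ n, t ≤ q n → condMean P t i l ≤ condMean P (q n) i l := by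
        simp_rw [ae_all_iff]
        exact fun n hn => hP.condMean_mono h hn i
      filter_upwards [h1] with l hl
      exact le_regPath_of_forall hq0 hl
    have hint : Integrable (fun l => (meanControl hq0 P l).1 t i) P₀ := by
      refine (hP.integrable_condMean h (q 0) i).mono' hAm.aestronglyMeasurable ?_
      filter_upwards [hdata] with l hl
      rw [Real.norm_of_nonneg ((meanControl hq0 P l).nonneg t i)]
      exact hl.regPath_le hq0 (hq0 ▸ ht) i
    refine ((integral_eq_iff_of_ae_le (hP.integrable_condMean h t i) hint hle).1 ?_).symm
    refine le_antisymm (integral_mono_ae (hP.integrable_condMean h t i) hint hle) ?_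
    obtain ⟨j, hj, hjt⟩ := exists_seq_gt_tendsto hq ht
    have h2 : Tendsto (fun m => ∫ ω, ω.2.1 (q (j m)) i ∂P) atTop (𝓝 (∫ ω, ω.2.1 t i ∂P)) := by
      refine tendsto_integral_of_dominated_convergence (fun ω => ω.2.1 (finalTime T) i)
        (fun m => (integrable_of_expectedTotal h (q (j m)) i).aestronglyMeasurable)
        (integrable_of_expectedTotal h _ i) (fun m => ae_of_all _ fun ω => ?_)
        (ae_of_all _ fun ω => ?_)
      · rw [Real.norm_of_nonneg (ω.2.nonneg _ i)]
        exact ω.2.le_final _ i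
      · exact (ω.2.continuousWithinAt_apply t i).tendsto.comp
          (tendsto_nhdsWithin_iff.2 ⟨hjt, Eventually.of_forall fun m => (hj m).le⟩)
    rw [hP.integral_condMean h t i]
    refine ge_of_tendsto' h2 fun m => ?_
    rw [← hP.integral_condMean h (q (j m)) i]
    refine integral_mono_ae hint (hP.integrable_condMean h _ i) ?_
    filter_upwards [hdata] with l hl
    exact hl.regPath_le hq0 (hj m) i

theorem IsAdmissible.isControl_meanControl (hP : IsAdmissible P₀ P) (h : expectedTotal P ≠ ∞)
    (hq0 : q 0 = finalTime T) (hq : DenseRange q) : IsControl P₀ (meanControl hq0 P) where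
  measurable := measurable_meanControl hq0
  adapted t i := EventuallyMeasurable.congr (hP.condMean_adapted h t i)
    (hP.meanControl_ae_eq h hq0 hq t i)

theorem IsAdmissible.meanControl_eq_toLp (hP : IsAdmissible P₀ P) (h : expectedTotal P ≠ ∞)
    (hq0 : q 0 = finalTime T) (hq : DenseRange q) (t : Time T) :
    ∀ᵐ l ∂P₀, (meanControl hq0 P l).1 t = WithLp.toLp 2 fun i => condMean P t i l := by
  filter_upwards [ae_all_iff.2 fun i => hP.meanControl_ae_eq h hq0 hq t i] with l hl
  ext i
  exact hl i

/-- The optional projection of an admissible follower does not cost more. -/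
theorem IsAdmissible.lintegral_cost_meanControl_le [IsProbabilityMeasure P₀]
    (hP : IsAdmissible P₀ P) (h : expectedTotal P ≠ ∞)
    (hq0 : q 0 = finalTime T) (hq : DenseRange q) (c : CostData T d k)
    (hg : ∀ l, LowerSemicontinuousOn (c.g l) (orthant k))
    (hh : ∀ l, LowerSemicontinuousOn (c.h l) (orthant k)) :
    ∫⁻ l, c.cost (l, meanControl hq0 P l) ∂P₀ ≤ c.expectedCost P := by
  have hA := hP.isControl_meanControl h hq0 hq
  have hmap : ∀ F : PathSpace T d k → ℝ≥0∞, Measurable F →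
      ∫⁻ ω, F ω ∂(P₀.map fun l => (l, meanControl hq0 P l)) =
        ∫⁻ l, F (l, meanControl hq0 P l) ∂P₀ :=
    fun F hF => lintegral_map hF hA.measurable_graph
  have hterm : ∀ (φ : EuclideanSpace ℝ (Fin d) → EuclideanSpace ℝ (Fin k) → ℝ)
      (_ : Measurable fun p : EuclideanSpace ℝ (Fin d) × orthant k => φ p.1 p.2)
      (_ : ∀ l, ∀ a ∈ orthant k, 0 ≤ φ l a) (_ : ∀ l, ConvexOn ℝ (orthant k) (φ l))
      (_ : ∀ l, LowerSemicontinuousOn (φ l) (orthant k)) (t : Time T),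
      ∫⁻ ω, orthantExt φ (ω.1.1 t) (ω.2.1 t) ∂(P₀.map fun l => (l, meanControl hq0 P l)) ≤
        ∫⁻ ω, orthantExt φ (ω.1.1 t) (ω.2.1 t) ∂P := by
    intro φ hφ h0 hc hl t
    rw [hmap (fun ω => orthantExt φ (ω.1.1 t) (ω.2.1 t)) ((measurable_orthantExt hφ).comp
      (((SkorokhodSpace.measurable_eval t).comp measurable_fst).prodMk (measurable_eval_snd t)))]
    refine le_trans (le_of_eq (lintegral_congr_ae ?_))
      (hP.lintegral_orthantExt_condMean_le h hφ h0 hc hl t)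
    filter_upwards [hP.meanControl_eq_toLp h hq0 hq t] with l hl
    simp only [hl]
  -- The projection preserves the mean path, so this part of the cost is unchanged.
  have hctrl : ∫⁻ ω, ENNReal.ofReal (realControlCost c.f ω.2)
      ∂(P₀.map fun l => (l, meanControl hq0 P l)) =
      ∫⁻ ω, ENNReal.ofReal (realControlCost c.f ω.2) ∂P := by
    rw [hmap _ c.measurable_controlCost]
    refine lintegral_realControlCost_congr (A := meanControl hq0 P) (B := Prod.snd)
      hA.measurable measurable_snd (fun i => ?_)
      (integrable_final_of_expectedTotal h) (fun t i => ?_) c.f_continuous c.f_mem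
    · exact (hP.integrable_condMean h _ i).congr (hP.meanControl_ae_eq h hq0 hq _ i).symm
    · rw [integral_congr_ae (hP.meanControl_ae_eq h hq0 hq t i), hP.integral_condMean h]
  rw [← hA.expectedCost_map, c.expectedCost_eq, c.expectedCost_eq, hctrl]
  exact add_le_add (add_le_add le_rfl (lintegral_mono fun t =>
    hterm c.h c.h_measurable c.h_nonneg c.h_convex hh t))
    (hterm c.g c.g_measurable c.g_nonneg c.g_convex hg (finalTime T))

end Projection

/-! ### Convexity of the cost along midpoints -/

section Midpoint

open Polynomial

variable {T : ℝ} [hT : Fact (0 < T)] {d k : ℕ}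

/-- The midpoint of two paths. -/
noncomputable def midPath (a b : MonotonePathSpace T k) : MonotonePathSpace T k :=
  MonotonePathSpace.mk' (fun t i => 2⁻¹ * a.1 t i + 2⁻¹ * b.1 t i)
    (fun t i => add_nonneg (mul_nonneg (by norm_num) (a.nonneg t i))
      (mul_nonneg (by norm_num) (b.nonneg t i)))
    (fun i => ((a.2.2.1 i).const_mul (by norm_num)).add ((b.2.2.1 i).const_mul (by norm_num)))
    fun i t => ((a.continuousWithinAt_apply t i).const_mul _).add
      ((b.continuousWithinAt_apply t i).const_mul _)

@[simp]
theorem midPath_apply (a b : MonotonePathSpace T k) (t : Time T) (i : Fin k) :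
    (midPath a b).1 t i = 2⁻¹ * a.1 t i + 2⁻¹ * b.1 t i := rfl

theorem midPath_eq (a b : MonotonePathSpace T k) (t : Time T) :
    (midPath a b).1 t = (2⁻¹ : ℝ) • a.1 t + (2⁻¹ : ℝ) • b.1 t := rfl

theorem polyControlCost_midPath (p : Fin k → ℝ[X]) (a b : MonotonePathSpace T k) :
    polyControlCost p (midPath a b) = 2⁻¹ * polyControlCost p a + 2⁻¹ * polyControlCost p b := by
  simp only [polyControlCost, Finset.mul_sum, ← Finset.sum_add_distrib]
  refine Finset.sum_congr rfl fun i _ => ?_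
  have h1 : ∀ s : Time T, (p i).derivative.eval (s : ℝ) * (midPath a b).1 s i =
      2⁻¹ * ((p i).derivative.eval (s : ℝ) * a.1 s i) +
        2⁻¹ * ((p i).derivative.eval (s : ℝ) * b.1 s i) := fun s => by
    rw [midPath_apply]; ring
  simp_rw [h1]
  rw [integral_add ((integrable_poly_mul_path _ a i).const_mul _)
    ((integrable_poly_mul_path _ b i).const_mul _), integral_const_mul, integral_const_mul,
    midPath_apply]
  ring

/-- The integration-by-parts formula is linear in the path, and this passes to the limit of
polynomial integrands. -/
theorem realControlCost_midPath {f : Time T → EuclideanSpace ℝ (Fin k)} (hf : Continuous f)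
    (a b : MonotonePathSpace T k) :
    realControlCost f (midPath a b) = 2⁻¹ * realControlCost f a + 2⁻¹ * realControlCost f b := by
  obtain ⟨p, hp⟩ := exists_polynomial_approx hf
  refine tendsto_nhds_unique (tendsto_polyControlCost hf hp (midPath a b)) ?_
  simp_rw [polyControlCost_midPath]
  exact ((tendsto_polyControlCost hf hp a).const_mul _).add
    ((tendsto_polyControlCost hf hp b).const_mul _)

theorem ofReal_half_mul_add {x y : ℝ} (hx : 0 ≤ x) (hy : 0 ≤ y) :
    ENNReal.ofReal (2⁻¹ * x + 2⁻¹ * y) = 2⁻¹ * (ENNReal.ofReal x + ENNReal.ofReal y) := by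
  rw [← mul_add, ENNReal.ofReal_mul (by norm_num), ENNReal.ofReal_add hx hy,
    ENNReal.ofReal_inv_of_pos (by norm_num), ENNReal.ofReal_ofNat]

theorem orthantExt_midpoint_le {φ : EuclideanSpace ℝ (Fin d) → EuclideanSpace ℝ (Fin k) → ℝ}
    (h0 : ∀ l, ∀ a ∈ orthant k, 0 ≤ φ l a) (hc : ∀ l, ConvexOn ℝ (orthant k) (φ l))
    (l : EuclideanSpace ℝ (Fin d)) {x y : EuclideanSpace ℝ (Fin k)} (hx : x ∈ orthant k)
    (hy : y ∈ orthant k) :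
    orthantExt φ l ((2⁻¹ : ℝ) • x + (2⁻¹ : ℝ) • y) ≤
      2⁻¹ * (orthantExt φ l x + orthantExt φ l y) := by
  have hxy : (2⁻¹ : ℝ) • x + (2⁻¹ : ℝ) • y ∈ orthant k :=
    (hc l).1 hx hy (by norm_num) (by norm_num) (by norm_num)
  rw [orthantExt_of_mem _ _ hx, orthantExt_of_mem _ _ hy, orthantExt_of_mem _ _ hxy,
    ← ofReal_half_mul_add (h0 l x hx) (h0 l y hy)]
  exact ENNReal.ofReal_le_ofReal
    ((hc l).2 hx hy (by norm_num) (by norm_num) (by norm_num))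

theorem CostData.cost_midPath_le (c : CostData T d k) (l : SkorokhodSpace T d)
    (a b : MonotonePathSpace T k) :
    c.cost (l, midPath a b) ≤ 2⁻¹ * (c.cost (l, a) + c.cost (l, b)) := by
  simp only [c.cost_eq]
  have h1 : ENNReal.ofReal (realControlCost c.f (midPath a b)) =
      2⁻¹ * (ENNReal.ofReal (realControlCost c.f a) + ENNReal.ofReal (realControlCost c.f b)) := by
    rw [realControlCost_midPath c.f_continuous, ofReal_half_mul_add
      (realControlCost_nonneg c.f_mem a) (realControlCost_nonneg c.f_mem b)]
  have h2 : c.runningCost (l, midPath a b) ≤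
      2⁻¹ * (c.runningCost (l, a) + c.runningCost (l, b)) := by
    have hm : ∀ a : MonotonePathSpace T k,
        Measurable fun t => orthantExt c.h (l.1 t) (a.1 t) := fun a =>
      c.measurable_running_uncurry.comp (measurable_prodMk_left (x := ((l, a) : PathSpace T d k)))
    simp only [CostData.runningCost]
    rw [← lintegral_add_left (hm a),
      ← lintegral_const_mul 2⁻¹ (f := fun t => orthantExt c.h (l.1 t) (a.1 t) +
        orthantExt c.h (l.1 t) (b.1 t)) ((hm a).add (hm b))]
    refine lintegral_mono fun t => ?_
    rw [midPath_eq]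
    exact orthantExt_midpoint_le c.h_nonneg c.h_convex _ (a.mem_orthant t) (b.mem_orthant t)
  have h3 : c.terminalCost (l, midPath a b) ≤
      2⁻¹ * (c.terminalCost (l, a) + c.terminalCost (l, b)) := by
    simp only [CostData.terminalCost]
    rw [midPath_eq]
    exact orthantExt_midpoint_le c.g_nonneg c.g_convex _ (a.mem_orthant _) (b.mem_orthant _)
  refine (add_le_add (add_le_add h1.le h2) h3).trans_eq ?_
  ring

theorem IsControl.mid {P₀ : Measure (SkorokhodSpace T d)}
    {A B : SkorokhodSpace T d → MonotonePathSpace T k} (hA : IsControl P₀ A)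
    (hB : IsControl P₀ B) : IsControl P₀ fun l => midPath (A l) (B l) where
  measurable := by
    refine MonotonePathSpace.measurable_mk fun t i => ?_
    have h : ∀ {A : SkorokhodSpace T d → MonotonePathSpace T k}, Measurable A →
        Measurable fun l => (A l).1 t i := fun hA =>
      (measurable_euclideanSpace_apply i).comp ((MonotonePathSpace.measurable_eval t).comp hA)
    exact ((h hA.measurable).const_mul 2⁻¹).add ((h hB.measurable).const_mul 2⁻¹)
  adapted t i := ((hA.adapted t i).const_mul (2⁻¹ : ℝ)).add ((hB.adapted t i).const_mul (2⁻¹ : ℝ))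

theorem IsControl.lintegral_cost_mid_le {P₀ : Measure (SkorokhodSpace T d)}
    {A B : SkorokhodSpace T d → MonotonePathSpace T k} (hA : IsControl P₀ A)
    (hB : IsControl P₀ B) (c : CostData T d k) {v : ℝ≥0∞}
    (hAv : ∫⁻ l, c.cost (l, A l) ∂P₀ ≤ v) (hBv : ∫⁻ l, c.cost (l, B l) ∂P₀ ≤ v) :
    ∫⁻ l, c.cost (l, midPath (A l) (B l)) ∂P₀ ≤ v := by
  have hmA : Measurable fun l => c.cost (l, A l) := c.measurable_cost.comp hA.measurable_graph
  have hmB : Measurable fun l => c.cost (l, B l) := c.measurable_cost.comp hB.measurable_graph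
  calc ∫⁻ l, c.cost (l, midPath (A l) (B l)) ∂P₀
      ≤ ∫⁻ l, 2⁻¹ * (c.cost (l, A l) + c.cost (l, B l)) ∂P₀ :=
        lintegral_mono fun l => c.cost_midPath_le l (A l) (B l)
    _ = 2⁻¹ * (∫⁻ l, c.cost (l, A l) ∂P₀ + ∫⁻ l, c.cost (l, B l) ∂P₀) := by
        rw [← lintegral_add_left hmA]
        exact lintegral_const_mul _ (hmA.add hmB)
    _ ≤ 2⁻¹ * (v + v) := by gcongr
    _ = v := by rw [← two_mul, ← mul_assoc, ENNReal.inv_mul_cancel (by norm_num) (by norm_num),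
        one_mul]

end Midpoint

/-! ### Lower semicontinuity of the cost -/

section Semicontinuity

open Polynomial

variable {T : ℝ} [hT : Fact (0 < T)] {d k : ℕ}

theorem liminf_add_liminf_le (u v : ℕ → ℝ≥0∞) :
    liminf u atTop + liminf v atTop ≤ liminf (fun n => u n + v n) atTop := by
  simp only [liminf_eq_iSup_iInf_of_nat]
  rw [ENNReal.iSup_add_iSup_of_monotone]
  · refine iSup_mono fun n => le_iInf₂ fun m hm => add_le_add (iInf₂_le m hm) (iInf₂_le m hm)
  · exact fun n m hnm => le_iInf₂ fun j hj => iInf₂_le j (hnm.trans hj)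
  · exact fun n m hnm => le_iInf₂ fun j hj => iInf₂_le j (hnm.trans hj)

theorem orthantExt_le_liminf {φ : EuclideanSpace ℝ (Fin d) → EuclideanSpace ℝ (Fin k) → ℝ}
    {l : EuclideanSpace ℝ (Fin d)} (hl : LowerSemicontinuousOn (φ l) (orthant k))
    {x : ℕ → EuclideanSpace ℝ (Fin k)} {y : EuclideanSpace ℝ (Fin k)}
    (hx : ∀ n, x n ∈ orthant k) (hy : y ∈ orthant k) (hxy : Tendsto x atTop (𝓝 y)) :
    orthantExt φ l y ≤ liminf (fun n => orthantExt φ l (x n)) atTop := by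
  rw [orthantExt_of_mem _ _ hy]
  refine le_of_forall_lt fun c hc => ?_
  obtain ⟨r, hcr, hr⟩ := exists_between hc
  refine hcr.trans_le (le_liminf_of_le (by isBoundedDefault) ?_)
  have h1 : r.toReal < φ l y := (ENNReal.lt_ofReal_iff_toReal_lt (hr.trans_le le_top).ne).1 hr
  have h2 := (tendsto_nhdsWithin_iff.2 ⟨hxy, Eventually.of_forall hx⟩).eventually (hl y hy _ h1)
  filter_upwards [h2] with n hn
  rw [orthantExt_of_mem _ _ (hx n)]
  exact ((ENNReal.lt_ofReal_iff_toReal_lt (hr.trans_le le_top).ne).2 hn).le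

variable {q : ℕ → Time T}

theorem tendsto_polyControlCost_path (hq0 : q 0 = finalTime T) (hq : DenseRange q)
    {a : ℕ → MonotonePathSpace T k} {x : ℕ → Fin k → ℝ}
    (h : ∀ j i, Tendsto (fun n => (a n).1 (q j) i) atTop (𝓝 (x j i))) (p : Fin k → ℝ[X]) :
    Tendsto (fun n => polyControlCost p (a n)) atTop
      (𝓝 (polyControlCost p (regPath hq0 x))) := by
  have hfin := tendsto_euclideanSpace_iff.1 (tendsto_path_final hq0 h)
  refine tendsto_finsetSum _ fun i _ => ((hfin i).const_mul _).sub ?_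
  obtain ⟨M, hM⟩ := (hfin i).bddAbove_range
  obtain ⟨C, hC⟩ := exists_norm_eval_le (T := T) (p i).derivative
  refine tendsto_integral_of_dominated_convergence (fun _ => C * M)
    (fun n => (integrable_poly_mul_path _ (a n) i).aestronglyMeasurable) (integrable_const _)
    (fun n => ae_of_all _ fun s => ?_) ?_
  · rw [norm_mul, Real.norm_of_nonneg ((a n).nonneg s i)]
    exact mul_le_mul (hC s) (((a n).le_final s i).trans (hM ⟨n, rfl⟩)) ((a n).nonneg s i)
      ((norm_nonneg _).trans (hC s))
  · filter_upwards [ae_tendsto_path hq0 hq h] with s hs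
    exact (tendsto_euclideanSpace_iff.1 hs i).const_mul _

/-- The terminal values converge, hence are bounded, so polynomial approximation is uniform in `n`
and the limits in `n` and in the polynomials may be exchanged. -/
theorem tendsto_realControlCost_path (hq0 : q 0 = finalTime T) (hq : DenseRange q)
    {a : ℕ → MonotonePathSpace T k} {x : ℕ → Fin k → ℝ}
    (h : ∀ j i, Tendsto (fun n => (a n).1 (q j) i) atTop (𝓝 (x j i)))
    {f : Time T → EuclideanSpace ℝ (Fin k)} (hf : Continuous f) :
    Tendsto (fun n => realControlCost f (a n)) atTop
      (𝓝 (realControlCost f (regPath hq0 x))) := by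
  obtain ⟨p, hp⟩ := exists_polynomial_approx hf
  have hfin := tendsto_euclideanSpace_iff.1 (tendsto_path_final hq0 h)
  have hsum : Tendsto (fun n => ∑ i, (a n).1 (finalTime T) i) atTop
      (𝓝 (∑ i, (regPath hq0 x).1 (finalTime T) i)) := tendsto_finsetSum _ fun i _ => hfin i
  obtain ⟨M, hM⟩ := hsum.bddAbove_range
  have hunif : TendstoUniformly (fun m n => polyControlCost (p m) (a n))
      (fun n => realControlCost f (a n)) atTop := by
    rw [Metric.tendstoUniformly_iff]
    intro ε hε
    have h1 : Tendsto (fun m : ℕ => 1 / ((m : ℝ) + 1) * M) atTop (𝓝 0) := by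
      simpa using (tendsto_one_div_add_atTop_nhds_zero_nat (𝕜 := ℝ)).mul_const M
    filter_upwards [h1.eventually_lt_const hε] with m hm n
    rw [dist_comm, Real.dist_eq]
    refine (abs_polyControlCost_sub_le hf (hp m) (a n)).trans_lt (lt_of_le_of_lt ?_ hm)
    exact mul_le_mul_of_nonneg_left (hM ⟨n, rfl⟩) (by positivity)
  exact hunif.tendsto_of_eventually_tendsto
    (Eventually.of_forall fun m => tendsto_polyControlCost_path hq0 hq h (p m))
    (tendsto_polyControlCost hf hp _)

/-- Lower semicontinuity of the cost. -/
theorem CostData.cost_le_liminf (c : CostData T d k)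
    (hg : ∀ l, LowerSemicontinuousOn (c.g l) (orthant k))
    (hh : ∀ l, LowerSemicontinuousOn (c.h l) (orthant k))
    (hq0 : q 0 = finalTime T) (hq : DenseRange q) (l : SkorokhodSpace T d)
    {a : ℕ → MonotonePathSpace T k} {x : ℕ → Fin k → ℝ}
    (h : ∀ j i, Tendsto (fun n => (a n).1 (q j) i) atTop (𝓝 (x j i))) :
    c.cost (l, regPath hq0 x) ≤ liminf (fun n => c.cost (l, a n)) atTop := by
  simp only [c.cost_eq]
  have h1 : ENNReal.ofReal (realControlCost c.f (regPath hq0 x)) ≤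
      liminf (fun n => ENNReal.ofReal (realControlCost c.f (a n))) atTop :=
    ((ENNReal.tendsto_ofReal (tendsto_realControlCost_path hq0 hq h c.f_continuous)).liminf_eq).ge
  have h2 : c.runningCost (l, regPath hq0 x) ≤
      liminf (fun n => c.runningCost (l, a n)) atTop := by
    refine le_trans (lintegral_mono_ae ?_) (lintegral_liminf_le fun n =>
      c.measurable_running_uncurry.comp (measurable_prodMk_left (x := ((l, a n) : PathSpace T d k))))
    filter_upwards [ae_tendsto_path hq0 hq h] with t ht
    exact orthantExt_le_liminf (hh _) (fun n => (a n).mem_orthant t)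
      ((regPath hq0 x).mem_orthant t) ht
  have h3 : c.terminalCost (l, regPath hq0 x) ≤
      liminf (fun n => c.terminalCost (l, a n)) atTop :=
    orthantExt_le_liminf (hg _) (fun n => (a n).mem_orthant _)
      ((regPath hq0 x).mem_orthant _) (tendsto_path_final hq0 h)
  exact (add_le_add ((add_le_add h1 h2).trans (liminf_add_liminf_le _ _)) h3).trans
    (liminf_add_liminf_le _ _)

end Semicontinuity

/-! ### Almost minimizers of a strictly convex functional -/

section Minimization

/-- Almost minimizers of a bounded function along a decreasing sequence of midpoint-closed sets. -/
theorem exists_seq_midpoint_gap_le {α : Type*} {S : ℕ → Set α} (hS : Antitone S)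
    (hne : ∀ n, (S n).Nonempty) {Φ : α → ℝ} {M : ℝ} (hΦ : ∀ a, |Φ a| ≤ M) {mid : α → α → α}
    (hmid : ∀ n, ∀ a ∈ S n, ∀ b ∈ S n, mid a b ∈ S n) {ε : ℕ → ℝ} (hε : ∀ n, 0 < ε n)
    (hanti : Antitone ε) :
    ∃ a : ℕ → α, (∀ n, a n ∈ S n) ∧ ∀ N n m, N ≤ n → N ≤ m →
      Φ (a n) + Φ (a m) - 2 * Φ (mid (a n) (a m)) ≤ ε N := by
  set J : ℕ → ℝ := fun n => sInf (Φ '' S n) with hJ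
  have hbdd : ∀ n, BddBelow (Φ '' S n) := fun n =>
    ⟨-M, by rintro _ ⟨a, -, rfl⟩; exact (abs_le.1 (hΦ a)).1⟩
  have hJle : ∀ n, ∀ a ∈ S n, J n ≤ Φ a := fun n a ha => csInf_le (hbdd n) ⟨a, ha, rfl⟩
  have hJM : BddAbove (range J) := by
    refine ⟨M, ?_⟩
    rintro _ ⟨n, rfl⟩
    obtain ⟨a, ha⟩ := hne n
    exact (hJle n a ha).trans (abs_le.1 (hΦ a)).2
  have hJmono : Monotone J := fun n m hnm =>
    csInf_le_csInf (hbdd n) ((hne m).image Φ) (image_mono (hS hnm))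
  -- The infima `J` increase to a finite supremum. Past `K n` they are within `ε n / 4` of it, so
  -- both an almost minimizer and the later midpoints have values close to the supremum; the four
  -- errors of `ε N / 4` add up to `ε N`.
  have hK : ∀ n, ∃ K, n ≤ K ∧ (⨆ j, J j) - ε n / 4 < J K := by
    intro n
    obtain ⟨K, hK⟩ := exists_lt_of_lt_ciSup
      (sub_lt_self (⨆ j, J j) (by linarith [hε n] : 0 < ε n / 4))
    exact ⟨max n K, le_max_left _ _, hK.trans_le (hJmono (le_max_right _ _))⟩
  choose K hKn hK using hK
  have ha : ∀ n, ∃ a ∈ S (K n), Φ a < J (K n) + ε n / 4 := by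
    intro n
    obtain ⟨_, ⟨a, ha, rfl⟩, hlt⟩ := exists_lt_of_csInf_lt ((hne (K n)).image Φ)
      (lt_add_of_pos_right (J (K n)) (by linarith [hε n] : 0 < ε n / 4))
    exact ⟨a, ha, hlt⟩
  choose a haS haΦ using ha
  refine ⟨a, fun n => hS (hKn n) (haS n), fun N n m hn hm => ?_⟩
  have h1 : ∀ n, N ≤ n → Φ (a n) ≤ (⨆ j, J j) + ε N / 4 := fun n hn => by
    linarith [haΦ n, le_ciSup hJM (K n), hanti hn]
  have h2 : (⨆ j, J j) - ε N / 4 ≤ Φ (mid (a n) (a m)) := by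
    rcases le_total (K n) (K m) with h | h
    · have := hJle (K n) _ (hmid (K n) _ (haS n) _ (hS h (haS m)))
      linarith [hK n, hanti hn]
    · have := hJle (K m) _ (hmid (K m) _ (hS h (haS n)) _ (haS m))
      linarith [hK m, hanti hm]
  linarith [h1 n hn, h1 m hm]

/-- With `x = exp (-a / 2)` and `y = exp (-b / 2)` this is `x² + y² - 2xy`. A small midpoint gap
thus means closeness of `x` and `y` in L². -/
theorem exp_gap_eq_sq (a b : ℝ) :
    Real.exp (-a) + Real.exp (-b) - 2 * Real.exp (-(2⁻¹ * a + 2⁻¹ * b)) =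
      (Real.exp (-a / 2) - Real.exp (-b / 2)) ^ 2 := by
  have h : ∀ x : ℝ, Real.exp (-x) = Real.exp (-x / 2) ^ 2 := fun x => by
    rw [← Real.exp_nat_mul]; congr 1; push_cast; ring
  have h3 : Real.exp (-(2⁻¹ * a + 2⁻¹ * b)) = Real.exp (-a / 2) * Real.exp (-b / 2) := by
    rw [← Real.exp_add]; congr 1; ring
  rw [h a, h b, h3]; ring

variable {X : Type*} [MeasurableSpace X]

/-- The L² distances are at most `(1 / 2) ^ (N + 1)`, strictly less than the summable bounds `(1 /
2) ^ N`, which forces convergence almost everywhere of the whole sequence. -/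
theorem ae_tendsto_of_integral_sq_sub_le {μ : Measure X} {u : ℕ → X → ℝ}
    (hu : ∀ n, MemLp (u n) 2 μ)
    (h : ∀ N n m, N ≤ n → N ≤ m → ∫ x, (u n x - u m x) ^ 2 ∂μ ≤ (1 / 4) ^ (N + 1)) :
    ∀ᵐ x ∂μ, ∃ y, Tendsto (fun n => u n x) atTop (𝓝 y) := by
  refine Lp.ae_tendsto_of_cauchy_eLpNorm (p := 2) (fun n => (hu n).aestronglyMeasurable)
    (by norm_num) (B := fun N => ENNReal.ofReal ((1 / 2) ^ N)) ?_ ?_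
  · exact (summable_geometric_of_lt_one (by norm_num) (by norm_num)).tsum_ofReal_ne_top
  · intro N n m hn hm
    rw [((hu n).sub (hu m)).eLpNorm_eq_integral_rpow_norm (by norm_num) (by norm_num)]
    refine (ENNReal.ofReal_lt_ofReal_iff (by positivity)).2 ?_
    have h1 : ∫ x, ‖(u n - u m) x‖ ^ (2 : ℝ≥0∞).toReal ∂μ = ∫ x, (u n x - u m x) ^ 2 ∂μ := by
      refine integral_congr_ae (ae_of_all _ fun x => ?_)
      simp
    rw [h1]
    have h2 : ((1 / 4 : ℝ) ^ (N + 1)) ^ (2 : ℝ≥0∞).toReal⁻¹ = (1 / 2) ^ (N + 1) := by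
      have : ((1 / 4 : ℝ) ^ (N + 1)) = ((1 / 2) ^ (N + 1)) ^ (2 : ℝ) := by
        rw [Real.rpow_two, ← pow_mul, mul_comm, pow_mul]; norm_num
      rw [this, ← Real.rpow_mul (by positivity)]
      norm_num
    refine lt_of_le_of_lt (Real.rpow_le_rpow (integral_nonneg fun x => sq_nonneg _)
      (h N n m hn hm) (by positivity)) ?_
    rw [h2]
    exact pow_lt_pow_right_of_lt_one₀ (by norm_num) (by norm_num) (Nat.lt_succ_self N)

/-- If `exp (-a n / 2)` converges and `a n` does not tend to infinity, then `a n` converges. -/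
theorem exists_tendsto_of_exp_tendsto {a : ℕ → ℝ} {u R : ℝ}
    (h : Tendsto (fun n => Real.exp (-a n / 2)) atTop (𝓝 u)) (hR : ∃ᶠ n in atTop, a n ≤ R) :
    ∃ y, Tendsto a atTop (𝓝 y) := by
  -- Infinitely often the exponential is at least `exp (-R / 2)`, so its limit is too, and the
  -- logarithm is continuous there.
  have hu : 0 < u := by
    refine (Real.exp_pos (-R / 2)).trans_le ?_
    by_contra hlt
    refine hR ((h.eventually_lt_const (not_le.1 hlt)).mono fun n hn hle => ?_)
    exact absurd (Real.exp_le_exp.2 (by linarith : -R / 2 ≤ -a n / 2)) (not_le.2 hn)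
  refine ⟨-2 * Real.log u, ?_⟩
  have := (((Real.continuousAt_log hu.ne').tendsto.comp h).const_mul (-2))
  refine this.congr fun n => ?_
  simp only [Function.comp, Real.log_exp]
  ring

end Minimization

/-! ### Selection of a convergent minimizing sequence and existence -/

section Existence

variable {T : ℝ} [hT : Fact (0 < T)] {d k : ℕ} {q : ℕ → Time T}
  {P₀ : Measure (SkorokhodSpace T d)}

theorem CostData.LinearlyCoercive.exists_expectedTotal_le {c : CostData T d k}
    (h : c.LinearlyCoercive P₀) {v : ℝ≥0∞} (hv : v ≠ ∞) :
    ∃ R : ℝ≥0∞, R ≠ ∞ ∧ ∀ P : Measure (PathSpace T d k), IsAdmissible P₀ P →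
      c.expectedCost P ≤ v → expectedTotal P ≤ R := by
  obtain ⟨κ, K, hκ, -, hcoer⟩ := h
  have hκ0 : ENNReal.ofReal κ ≠ 0 := by simpa using hκ
  refine ⟨max (ENNReal.ofReal K) (v / ENNReal.ofReal κ), ?_, fun P hP hPv => ?_⟩
  · exact (max_lt ENNReal.ofReal_lt_top (ENNReal.div_lt_top hv hκ0)).ne
  · rcases le_total (ENNReal.ofReal K) (expectedTotal P) with hle | hle
    · refine le_max_of_le_right ?_
      rw [ENNReal.le_div_iff_mul_le (Or.inl hκ0) (Or.inl ENNReal.ofReal_ne_top), mul_comm]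
      exact (hcoer P hP hle).trans hPv
    · exact le_max_of_le_left hle

/-- The controls whose cost is at most `v`. -/
def controlSet (P₀ : Measure (SkorokhodSpace T d)) (c : CostData T d k) (v : ℝ≥0∞) :
    Set (SkorokhodSpace T d → MonotonePathSpace T k) :=
  {A | IsControl P₀ A ∧ ∫⁻ l, c.cost (l, A l) ∂P₀ ≤ v}

/-- Coercivity makes `E|A_T|` finite for any admissible law of finite cost, which is what the
passage to conditional means requires. -/
theorem controlSet_nonempty [IsProbabilityMeasure P₀] {c : CostData T d k}
    (hg : ∀ l, LowerSemicontinuousOn (c.g l) (orthant k))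
    (hh : ∀ l, LowerSemicontinuousOn (c.h l) (orthant k)) (hcoer : c.LinearlyCoercive P₀)
    {v : ℝ≥0∞} (hv : c.value P₀ < v) : (controlSet P₀ c v).Nonempty := by
  obtain ⟨P, hP⟩ := iInf_lt_iff.1 hv
  obtain ⟨hP, hPv⟩ := iInf_lt_iff.1 hP
  have := hP.isProbabilityMeasure
  obtain ⟨R, hR, hRP⟩ := hcoer.exists_expectedTotal_le (hPv.trans_le le_top).ne
  have hfin : expectedTotal P ≠ ∞ := ((hRP P hP le_rfl).trans_lt hR.lt_top).ne
  obtain ⟨q, hq0, hq⟩ := exists_denseRange_seq T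
  exact ⟨meanControl hq0 P, hP.isControl_meanControl hfin hq0 hq,
    (hP.lintegral_cost_meanControl_le hfin hq0 hq c hg hh).trans hPv.le⟩

theorem IsControl.expectedTotal_map {A : SkorokhodSpace T d → MonotonePathSpace T k}
    (hA : IsControl P₀ A) : expectedTotal (P₀.map fun l => (l, A l)) =
      ∫⁻ l, ‖(A l).1 (finalTime T)‖ₑ ∂P₀ :=
  lintegral_map (measurable_eval_snd _).enorm hA.measurable_graph

/-- The coordinates of a control, sampled along a sequence of times. -/
def sampledControl (q : ℕ → Time T) (A : SkorokhodSpace T d → MonotonePathSpace T k)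
    (p : SkorokhodSpace T d × (ℕ × Fin k)) : ℝ :=
  (A p.1).1 (q p.2.1) p.2.2

theorem measurable_sampledControl (q : ℕ → Time T)
    {A : SkorokhodSpace T d → MonotonePathSpace T k} (hA : Measurable A) :
    Measurable (sampledControl q A) :=
  measurable_from_prod_countable_left fun j => (measurable_euclideanSpace_apply j.2).comp
    ((MonotonePathSpace.measurable_eval (q j.1)).comp hA)

theorem norm_exp_neg_le_one {x : ℝ} (hx : 0 ≤ x) : ‖Real.exp (-x)‖ ≤ 1 := by
  rw [Real.norm_of_nonneg (Real.exp_pos _).le]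
  exact Real.exp_le_one_iff.2 (neg_nonpos.2 hx)

/-- From the sets of almost optimal controls one can select a sequence along which
`exp (-A / 2)` converges almost surely at countably many times. -/
theorem exists_seq_controls_exp_tendsto [IsFiniteMeasure P₀] {c : CostData T d k}
    {v : ℕ → ℝ≥0∞} (hv : Antitone v) (hne : ∀ n, (controlSet P₀ c (v n)).Nonempty)
    (q : ℕ → Time T) :
    ∃ A : ℕ → SkorokhodSpace T d → MonotonePathSpace T k, (∀ n, A n ∈ controlSet P₀ c (v n)) ∧
      ∀ᵐ l ∂P₀, ∀ j i, ∃ u, Tendsto (fun n => Real.exp (-(A n l).1 (q j) i / 2)) atTop (𝓝 u) := by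
  -- A finite measure with the null sets of counting measure: one bounded functional then controls
  -- every sampled time and coordinate.
  set ν : Measure (ℕ × Fin k) := Measure.count.toFinite with hν
  set μ := P₀.prod ν with hμ
  have hnn : ∀ (A : SkorokhodSpace T d → MonotonePathSpace T k) p, 0 ≤ sampledControl q A p :=
    fun A p => (A p.1).nonneg _ _
  have hint : ∀ {A : SkorokhodSpace T d → MonotonePathSpace T k}, Measurable A →
      Integrable (fun p => Real.exp (-sampledControl q A p)) μ := fun hA =>
    Integrable.of_bound (Real.measurable_exp.comp
      (measurable_sampledControl q hA).neg).aestronglyMeasurable 1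
      (ae_of_all _ fun p => norm_exp_neg_le_one (hnn _ p))
  obtain ⟨A, hA, hgap⟩ := exists_seq_midpoint_gap_le
    (S := fun n => controlSet P₀ c (v n))
    (fun n m hnm A hA => ⟨hA.1, hA.2.trans (hv hnm)⟩) hne
    (Φ := fun A => ∫ p, Real.exp (-sampledControl q A p) ∂μ) (M := 1 * μ.real univ)
    (fun A => norm_integral_le_of_norm_le_const
      (ae_of_all _ fun p => norm_exp_neg_le_one (hnn A p)))
    (mid := fun A B l => midPath (A l) (B l))
    (fun n A hA B hB => ⟨hA.1.mid hB.1, hA.1.lintegral_cost_mid_le hB.1 c hA.2 hB.2⟩)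
    (ε := fun N => (1 / 4) ^ (N + 1)) (fun N => by positivity)
    (fun N M hNM => pow_le_pow_of_le_one (by norm_num) (by norm_num) (by omega))
  refine ⟨A, hA, ?_⟩
  have hmeas : ∀ n, Measurable fun p => Real.exp (-sampledControl q (A n) p / 2) := fun n =>
    Real.measurable_exp.comp ((measurable_sampledControl q (hA n).1.measurable).neg.div_const 2)
  have hmem : ∀ n, MemLp (fun p => Real.exp (-sampledControl q (A n) p / 2)) 2 μ := fun n =>
    MemLp.of_bound (hmeas n).aestronglyMeasurable 1 (ae_of_all _ fun p => by
      rw [neg_div]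
      exact norm_exp_neg_le_one (div_nonneg (hnn _ p) (by norm_num)))
  have hae := ae_tendsto_of_integral_sq_sub_le hmem fun N n m hn hm => by
    refine le_trans (le_of_eq ?_) (hgap N n m hn hm)
    simp_rw [← exp_gap_eq_sq]
    have h1 := hint (hA n).1.measurable
    have h2 := hint (hA m).1.measurable
    have h3 := hint ((hA n).1.mid (hA m).1).measurable
    have h4 := integral_sub (h1.add h2) (h3.const_mul 2)
    rw [integral_add' h1 h2, integral_const_mul] at h4
    exact h4
  filter_upwards [Measure.ae_ae_of_ae_prod hae] with l hl j i
  rw [hν, ae_toFinite, Measure.ae_count_iff] at hl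
  exact hl (j, i)

theorem exists_seq_controls_tendsto [IsProbabilityMeasure P₀] {c : CostData T d k}
    (hcoer : c.LinearlyCoercive P₀) {v : ℕ → ℝ≥0∞} (hv : Antitone v) (hv0 : v 0 ≠ ∞)
    (hne : ∀ n, (controlSet P₀ c (v n)).Nonempty) (q : ℕ → Time T) :
    ∃ A : ℕ → SkorokhodSpace T d → MonotonePathSpace T k, (∀ n, A n ∈ controlSet P₀ c (v n)) ∧
      ∀ᵐ l ∂P₀, ∀ j i, ∃ y, Tendsto (fun n => (A n l).1 (q j) i) atTop (𝓝 y) := by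
  obtain ⟨A, hA, hexp⟩ := exists_seq_controls_exp_tendsto hv hne q
  refine ⟨A, hA, ?_⟩
  obtain ⟨R, hR, hRP⟩ := hcoer.exists_expectedTotal_le hv0
  have hbound : ∀ n, ∫⁻ l, ‖(A n l).1 (finalTime T)‖ₑ ∂P₀ ≤ R := fun n => by
    rw [← (hA n).1.expectedTotal_map]
    refine hRP _ (hA n).1.isStronglyAdmissible.isAdmissible ?_
    rw [(hA n).1.expectedCost_map]
    exact (hA n).2.trans (hv (Nat.zero_le n))
  have hmeas : ∀ n, Measurable fun l => ‖(A n l).1 (finalTime T)‖ₑ := fun n =>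
    ((MonotonePathSpace.measurable_eval _).comp (hA n).1.measurable).enorm
  -- Finiteness of the lower limit rules out escape to infinity along the whole sequence. A bound
  -- for infinitely many `n` suffices, because the exponentials already converge.
  have hfatou : ∫⁻ l, liminf (fun n => ‖(A n l).1 (finalTime T)‖ₑ) atTop ∂P₀ ≠ ∞ := by
    refine ((lintegral_liminf_le hmeas).trans_lt ?_).ne
    refine lt_of_le_of_lt ?_ hR.lt_top
    exact (liminf_le_liminf (Eventually.of_forall hbound)).trans_eq (liminf_const R)
  filter_upwards [hexp, ae_lt_top (Measurable.liminf hmeas) hfatou] with l h1 h2 j i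
  obtain ⟨u, hu⟩ := h1 j i
  obtain ⟨r, hr, hrtop⟩ := exists_between h2
  refine exists_tendsto_of_exp_tendsto (R := r.toReal) hu ?_
  refine (frequently_lt_of_liminf_lt (by isBoundedDefault) hr).mono fun n hn => ?_
  refine ((A n l).le_final _ i).trans (((le_abs_self _).trans
    (PiLp.norm_apply_le ((A n l).1 (finalTime T)) i)).trans ?_)
  rw [← toReal_enorm]
  exact ENNReal.toReal_mono hrtop.ne hn.le

/-- The pointwise limit of controls. -/
noncomputable def limitControl (hq0 : q 0 = finalTime T)
    (A : ℕ → SkorokhodSpace T d → MonotonePathSpace T k) (l : SkorokhodSpace T d) :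
    MonotonePathSpace T k :=
  regPath hq0 fun j i => liminf (fun n => (A n l).1 (q j) i) atTop

theorem tendsto_liminf_of_exists {a : ℕ → ℝ} (h : ∃ y, Tendsto a atTop (𝓝 y)) :
    Tendsto a atTop (𝓝 (liminf a atTop)) := by
  obtain ⟨y, hy⟩ := h
  rwa [hy.liminf_eq]

/-- Lower limits are used as data because they are defined and measurable everywhere, and agree with
the limits almost surely. -/
theorem isControl_limitControl (hq0 : q 0 = finalTime T) (hq : DenseRange q)
    {A : ℕ → SkorokhodSpace T d → MonotonePathSpace T k} (hA : ∀ n, IsControl P₀ (A n))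
    (h : ∀ᵐ l ∂P₀, ∀ j i, ∃ y, Tendsto (fun n => (A n l).1 (q j) i) atTop (𝓝 y)) :
    IsControl P₀ (limitControl hq0 A) where
  measurable := measurable_regPath hq0 fun j i => Measurable.liminf fun n =>
    (measurable_euclideanSpace_apply i).comp
      ((MonotonePathSpace.measurable_eval (q j)).comp (hA n).measurable)
  adapted t i := by
    have hlim : ∀ j, Measurable[completedSigma P₀ (q j)]
        fun l => liminf (fun n => (A n l).1 (q j) i) atTop := fun j =>
      Measurable.liminf fun n => (hA n).adapted (q j) i
    have hdata : ∀ᵐ l ∂P₀, IsMonotoneData q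
        fun j i => liminf (fun n => (A n l).1 (q j) i) atTop := by
      filter_upwards [h] with l hl
      exact isMonotoneData_of_tendsto fun j i => tendsto_liminf_of_exists (hl j i)
    rcases (le_finalTime t).eq_or_lt with rfl | ht
    · have h0 := hlim 0
      rw [hq0] at h0
      refine EventuallyMeasurable.congr h0 ?_
      filter_upwards [hdata] with l hl
      rw [limitControl, hl.regPath_final hq0, hq0]
    · obtain ⟨j, hj, hjt⟩ := exists_seq_gt_tendsto hq ht
      intro S hS
      refine iInf_completion_le P₀ t fun s hs => ?_
      obtain ⟨N, hN⟩ := eventually_atTop.1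
        (((continuous_subtype_val.tendsto t).comp hjt).eventually_lt_const hs)
      -- Dropping the first `N` terms leaves only times `q (j m) < s`, so the limit is measurable
      -- for the completed σ-algebra at `s`; since `s > t` is arbitrary, right-continuity of the
      -- completed filtration gives adaptedness at `t`.
      have hm : Measurable[eventuallyMeasurableSpace (pathSigma T d s) (ae P₀)] fun l =>
          liminf (fun m => liminf (fun n => (A n l).1 (q (j (m + N))) i) atTop) atTop :=
        Measurable.liminf fun m => (hlim (j (m + N))).mono (eventuallyMeasurableSpace_mono
          (pathSigmaPlus_le_pathSigma T d (hN (m + N) (Nat.le_add_left _ _))) _) le_rfl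
      have hcongr : (fun l => (limitControl hq0 A l).1 t i) =ᵐ[P₀] fun l =>
          liminf (fun m => liminf (fun n => (A n l).1 (q (j (m + N))) i) atTop) atTop := by
        filter_upwards [hdata] with l hl
        exact ((hl.tendsto_regPath hq0 hj hjt i).comp (tendsto_add_atTop_nat N)).liminf_eq.symm
      exact EventuallyMeasurable.congr hm hcongr hS

theorem lintegral_cost_limitControl_le (hq0 : q 0 = finalTime T) (hq : DenseRange q)
    {c : CostData T d k} (hg : ∀ l, LowerSemicontinuousOn (c.g l) (orthant k))
    (hh : ∀ l, LowerSemicontinuousOn (c.h l) (orthant k))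
    {A : ℕ → SkorokhodSpace T d → MonotonePathSpace T k} (hA : ∀ n, IsControl P₀ (A n))
    (h : ∀ᵐ l ∂P₀, ∀ j i, ∃ y, Tendsto (fun n => (A n l).1 (q j) i) atTop (𝓝 y)) :
    ∫⁻ l, c.cost (l, limitControl hq0 A l) ∂P₀ ≤
      liminf (fun n => ∫⁻ l, c.cost (l, A n l) ∂P₀) atTop := by
  refine le_trans (lintegral_mono_ae ?_) (lintegral_liminf_le fun n =>
    c.measurable_cost.comp (hA n).measurable_graph)
  filter_upwards [h] with l hl
  exact c.cost_le_liminf hg hh hq0 hq l fun j i => tendsto_liminf_of_exists (hl j i)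

/-- There is a control whose cost is at most the value of the problem. -/
theorem exists_control_cost_le_value [IsProbabilityMeasure P₀] {c : CostData T d k}
    (hg : ∀ l, LowerSemicontinuousOn (c.g l) (orthant k))
    (hh : ∀ l, LowerSemicontinuousOn (c.h l) (orthant k)) (hcoer : c.LinearlyCoercive P₀)
    (hvalue : c.value P₀ < ∞) :
    ∃ A : SkorokhodSpace T d → MonotonePathSpace T k, IsControl P₀ A ∧
      ∫⁻ l, c.cost (l, A l) ∂P₀ ≤ c.value P₀ := by
  obtain ⟨v, hanti, hgt, htend⟩ := exists_seq_strictAnti_tendsto' hvalue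
  obtain ⟨q, hq0, hq⟩ := exists_denseRange_seq T
  obtain ⟨A, hA, hlim⟩ := exists_seq_controls_tendsto hcoer hanti.antitone (hgt 0).2.ne
    (fun n => controlSet_nonempty hg hh hcoer (hgt n).1) q
  refine ⟨limitControl hq0 A, isControl_limitControl hq0 hq (fun n => (hA n).1) hlim, ?_⟩
  refine (lintegral_cost_limitControl_le hq0 hq hg hh (fun n => (hA n).1) hlim).trans ?_
  exact (liminf_le_liminf (Eventually.of_forall fun n => (hA n).2)).trans_eq htend.liminf_eq

end Existence

end MonotoneFollower

theorem theorem2p5 (T : ℝ) [Fact (0 < T)] (d k : ℕ)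
    (P₀ : MeasureTheory.Measure (MonotoneFollower.SkorokhodSpace T d))
    [MeasureTheory.IsProbabilityMeasure P₀]
    (c : MonotoneFollower.CostData T d k)
    (hg : ∀ l, LowerSemicontinuousOn (c.g l) (MonotoneFollower.orthant k))
    (hh : ∀ l, LowerSemicontinuousOn (c.h l) (MonotoneFollower.orthant k))
    (hcoercive : c.LinearlyCoercive P₀)
    (hvalue : c.value P₀ < ⊤) :
    ∃ P : MeasureTheory.Measure (MonotoneFollower.PathSpace T d k),
      c.IsStrongSolution P₀ P := by
  obtain ⟨A, hA, hcost⟩ :=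
    MonotoneFollower.exists_control_cost_le_value hg hh hcoercive hvalue
  have hadm := hA.isStronglyAdmissible
  rw [← hA.expectedCost_map] at hcost
  exact ⟨P₀.map fun l => (l, A l), ⟨hadm.isAdmissible, hcost.trans_lt hvalue,
    le_antisymm (iInf₂_le _ hadm.isAdmissible) hcost⟩, hadm⟩
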